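/- Let $M$ be a smooth, Hausdorff, second countable, connected manifold (without boundary) of dimension $n\ge 1$. Let $\mathcal D^1(M)=\operatorname{Vect}(M)\oplus C^\infty(M)$ be the real Lie algebra of linear differential operators of order at most one on $C^\infty(M)$, that is, of the operators $f\mapsto Xf+gf$ with $X$ a smooth vector field and $g$ a smooth function on $M$, with the commutator as bracket. Then the first Chevalley–Eilenberg cohomology group of $\mathcal D^1(M)$ with coefficients in the adjoint representation (the space of linear maps $C:\mathcal D^1(M)\to\mathcal D^1(M)$ with $C[P,Q]=[CP,Q]+[P,CQ]$ for all $P,Q$, modulo the maps $Q\mapsto[P,Q]$) satisfies, as a real vector space, $$H^1(\mathcal D^1(M),\mathcal D^1(M))\simeq\mathbb R^2\oplus H^1_{\mathrm{DR}}(M),$$ where $H^1_{\mathrm{DR}}(M)$ is the first de Rham cohomology space of $M$ (closed smooth $1$-forms modulo differentials of smooth functions). -/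

import Mathlib

open scoped Manifold ContDiff Bundle

attribute [local instance 100] LieRing.ofAssociativeRing

noncomputable section

namespace DiffOp

section Geometry

variable (n : ℕ) (M : Type*) [TopologicalSpace M] [ChartedSpace (EuclideanSpace ℝ (Fin n)) M]

/-- The algebra `C^∞(M)` of smooth real functions on `M`. -/
abbrev SmoothFun : Type _ := ContMDiffMap (𝓡 n) 𝓘(ℝ, ℝ) M ℝ ∞

variable [IsManifold (𝓡 n) ∞ M]

/-- Smooth vector fields on `M`: smooth sections of the tangent bundle. -/
abbrev VectField : Type _ :=
  ContMDiffSection (𝓡 n) (EuclideanSpace ℝ (Fin n)) ∞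
    (fun x : M => TangentSpace (𝓡 n) x)

/-- Smooth differential `1`-forms on `M`: smooth sections of the cotangent bundle. -/
abbrev OneForm : Type _ :=
  ContMDiffSection (𝓡 n) (EuclideanSpace ℝ (Fin n) →L[ℝ] ℝ) ∞
    (fun x : M => TangentSpace (𝓡 n) x →L[ℝ] Bundle.Trivial M ℝ x)

variable {n M}

theorem two_le_infty : (2 : WithTop ℕ∞) ≤ ∞ := by
  exact ENat.LEInfty.out

theorem mdiffAt (f : SmoothFun n M) (x : M) : MDifferentiableAt (𝓡 n) 𝓘(ℝ, ℝ) f x :=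
  (f.contMDiff x).mdifferentiableAt (by simp)

/-- The differential `df` of a smooth function is a smooth `1`-form. -/
theorem contMDiff_mvfderiv (f : SmoothFun n M) :
    ContMDiff (𝓡 n) ((𝓡 n).prod 𝓘(ℝ, EuclideanSpace ℝ (Fin n) →L[ℝ] ℝ)) ∞
      (fun x => Bundle.TotalSpace.mk' (EuclideanSpace ℝ (Fin n) →L[ℝ] ℝ)
        (E := fun x : M => TangentSpace (𝓡 n) x →L[ℝ] Bundle.Trivial M ℝ x) x
        (mvfderiv (𝓡 n) f x)) := by
  intro x
  rw [contMDiffAt_hom_bundle]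
  refine ⟨contMDiffAt_id, ?_⟩
  have h := (f.contMDiff x).mfderiv_const (m := ∞) (by simp)
  refine h.congr_of_eventuallyEq (Filter.Eventually.of_forall fun y => ?_)
  ext v
  simp [inTangentCoordinates, ContinuousLinearMap.inCoordinates, mvfderiv]
  rfl

/-- The de Rham differential `d : C^∞(M) → Ω¹(M)`. -/
def d : SmoothFun n M →ₗ[ℝ] OneForm n M where
  toFun f := ⟨fun x => mvfderiv (𝓡 n) f x, contMDiff_mvfderiv f⟩
  map_add' f g := by
    ext x v
    exact DFunLike.congr_fun (mvfderiv_add (mdiffAt f x) (mdiffAt g x)) v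
  map_smul' c f := by
    ext x v
    have h := mvfderiv_smul (I := 𝓡 n) (a := fun _ : M => c) (x := x)
      mdifferentiableAt_const (mdiffAt f x)
    rw [mvfderiv_const] at h
    have h2 := DFunLike.congr_fun h v
    simpa [Pi.smul_def] using! h2

theorem d_apply (f : SmoothFun n M) (x : M) : d f x = mvfderiv (𝓡 n) f x := rfl

/-- The evaluation `α(X)` of a `1`-form on a vector field. -/
def contract (α : OneForm n M) (X : VectField n M) : SmoothFun n M :=
  ⟨fun x => α x (X x), by
    have h := ContMDiff.clm_bundle_apply (b := fun x : M => x) α.contMDiff X.contMDiff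
    intro x
    exact (Bundle.contMDiffAt_totalSpace.1 (h x)).2⟩

/-- A vector field `X` acting on functions as the derivation `f ↦ X f = df(X)`. -/
def vectAct (X : VectField n M) : Module.End ℝ (SmoothFun n M) where
  toFun f := contract (d f) X
  map_add' f g := by
    ext x
    simp only [contract, map_add]
    rfl
  map_smul' c f := by
    ext x
    simp only [contract, map_smul]
    rfl

theorem vectAct_apply (X : VectField n M) (f : SmoothFun n M) (x : M) :
    vectAct X f x = mvfderiv (𝓡 n) f x (X x) := rfl

/-! The bracket of two vector fields, as operators, is again a vector field. -/

theorem isOpen_extTarget (x : M) : IsOpen (extChartAt (𝓡 n) x).target :=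
  isOpen_extChartAt_target x

theorem mdiffAt_symm (x : M) {y : EuclideanSpace ℝ (Fin n)}
    (hy : y ∈ (extChartAt (𝓡 n) x).target) :
    MDifferentiableAt 𝓘(ℝ, EuclideanSpace ℝ (Fin n)) (𝓡 n) (extChartAt (𝓡 n) x).symm y :=
  ((contMDiffOn_extChartAt_symm (n := ∞) x).contMDiffAt
    ((isOpen_extTarget x).mem_nhds hy)).mdifferentiableAt (by simp)

theorem contDiffAt_local (f : SmoothFun n M) (x : M) {y : EuclideanSpace ℝ (Fin n)}
    (hy : y ∈ (extChartAt (𝓡 n) x).target) :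
    ContDiffAt ℝ ∞ (fun z => f ((extChartAt (𝓡 n) x).symm z)) y := by
  have h := (contMDiffOn_extChartAt_symm (I := 𝓡 n) (n := ∞) x).contMDiffAt
    ((isOpen_extTarget x).mem_nhds hy)
  exact ((f.contMDiff _).comp y h).contDiffAt

theorem fderiv_local (f : SmoothFun n M) (x : M) {y : EuclideanSpace ℝ (Fin n)}
    (hy : y ∈ (extChartAt (𝓡 n) x).target) :
    fderiv ℝ (fun z => f ((extChartAt (𝓡 n) x).symm z)) y =
      (mvfderiv (𝓡 n) f ((extChartAt (𝓡 n) x).symm y)).comp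
        (mfderiv 𝓘(ℝ, EuclideanSpace ℝ (Fin n)) (𝓡 n) (extChartAt (𝓡 n) x).symm y) := by
  have h := mvfderiv_comp (g := f) y (mdiffAt f _) (mdiffAt_symm x hy)
  rw [← h]
  exact (mfderiv_eq_fderiv (𝕜 := ℝ)
    (f := fun z => f ((extChartAt (𝓡 n) x).symm z))).symm

/-- A vector field read in the chart at `x`. -/
def chartField (X : VectField n M) (x : M) :
    EuclideanSpace ℝ (Fin n) → EuclideanSpace ℝ (Fin n) :=
  VectorField.mpullbackWithin 𝓘(ℝ, EuclideanSpace ℝ (Fin n)) (𝓡 n)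
    (extChartAt (𝓡 n) x).symm (fun z => X z) (Set.range (𝓡 n))

theorem fderiv_local_chartField (f : SmoothFun n M) (X : VectField n M) (x : M)
    {y : EuclideanSpace ℝ (Fin n)} (hy : y ∈ (extChartAt (𝓡 n) x).target) :
    fderiv ℝ (fun z => f ((extChartAt (𝓡 n) x).symm z)) y (chartField X x y) =
      vectAct X f ((extChartAt (𝓡 n) x).symm y) := by
  have hinv := isInvertible_mfderivWithin_extChartAt_symm (I := 𝓡 n) hy
  rw [fderiv_local f x hy, vectAct_apply]
  have hr : Set.range (𝓡 n) = Set.univ := ModelWithCorners.range_eq_univ (𝓡 n)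
  simp only [chartField, VectorField.mpullbackWithin_apply]
  rw [hr, mfderivWithin_univ] at hinv ⊢
  obtain ⟨e, he⟩ := hinv
  rw [← he, ContinuousLinearMap.inverse_equiv]
  exact congrArg _ (e.apply_symm_apply _)

theorem differentiableAt_chartField (X : VectField n M) (x : M) :
    DifferentiableAt ℝ (chartField X x) (extChartAt (𝓡 n) x x) := by
  have : IsManifold (𝓡 n) 2 M := IsManifold.of_le (n := ∞) two_le_infty
  have hX : MDifferentiableWithinAt (𝓡 n) ((𝓡 n).prod 𝓘(ℝ, EuclideanSpace ℝ (Fin n)))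
      (fun z => (X z : TangentBundle (𝓡 n) M)) Set.univ x :=
    ((X.contMDiff x).mdifferentiableAt (by simp)).mdifferentiableWithinAt
  have h := hX.differentiableWithinAt_mpullbackWithin_vectorField
  rw [ModelWithCorners.range_eq_univ, Set.preimage_univ, Set.univ_inter] at h
  rw [chartField, ModelWithCorners.range_eq_univ]
  exact differentiableWithinAt_univ.1 h

/-- The Lie bracket of two smooth vector fields. -/
def bracket (X Y : VectField n M) : VectField n M :=
  ⟨fun x => VectorField.mlieBracket (𝓡 n) (fun z => X z) (fun z => Y z) x, fun x => by
    have : IsManifold (𝓡 n) (minSmoothness ℝ 2) M :=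
      IsManifold.of_le (n := ∞) (by simpa using two_le_infty)
    have : IsManifold (𝓡 n) (((⊤ : ℕ∞) : WithTop ℕ∞) + 1) M := by simpa
    exact ContMDiffAt.mlieBracket_vectorField (n := ⊤) (m := ⊤)
      (X.contMDiff x) (Y.contMDiff x) (by simp)⟩

theorem vectAct_bracket (X Y : VectField n M) :
    vectAct (bracket X Y) = ⁅vectAct X, vectAct Y⁆ := by
  ext f x
  have hx := mem_extChartAt_target (I := 𝓡 n) x
  have hnear : ∀ Z : VectField n M,
      (fun y => fderiv ℝ (fun z => f ((extChartAt (𝓡 n) x).symm z)) y (chartField Z x y))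
        =ᶠ[nhds (extChartAt (𝓡 n) x x)]
        fun y => vectAct Z f ((extChartAt (𝓡 n) x).symm y) := fun Z => by
    filter_upwards [(isOpen_extTarget x).mem_nhds hx] with y hy
    exact fderiv_local_chartField f Z x hy
  have key := VectorField.fderiv_apply_lieBracket (n := ∞) (contDiffAt_local f x hx)
    (by simpa using two_le_infty) (differentiableAt_chartField Y x) (differentiableAt_chartField X x)
  rw [(hnear X).fderiv_eq, (hnear Y).fderiv_eq, fderiv_local_chartField _ _ _ hx,
    fderiv_local_chartField _ _ _ hx, extChartAt_to_inv] at key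
  rw [LieRing.of_associative_ring_bracket]
  change _ = vectAct X (vectAct Y f) x - vectAct Y (vectAct X f) x
  rw [← key, vectAct_apply]
  change mvfderiv (𝓡 n) f x (VectorField.mlieBracket (𝓡 n) (fun z => X z) (fun z => Y z) x) = _
  have hb : VectorField.mlieBracket (𝓡 n) (fun z => X z) (fun z => Y z) x =
      VectorField.lieBracket ℝ (chartField X x) (chartField Y x) (extChartAt (𝓡 n) x x) := by
    rw [← VectorField.mlieBracketWithin_univ, VectorField.mlieBracketWithin_apply,
      mfderiv_extChartAt_self]
    rw [Set.preimage_univ, Set.univ_inter]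
    have hid : ∀ w : EuclideanSpace ℝ (Fin n),
        (ContinuousLinearMap.id ℝ (EuclideanSpace ℝ (Fin n))).inverse w = w := by simp
    refine (hid _).trans ?_
    have hr : Set.range (𝓡 n) = Set.univ := ModelWithCorners.range_eq_univ (𝓡 n)
    simp only [chartField, hr]
    exact congrFun VectorField.lieBracketWithin_univ _
  rw [hb, (mdiffAt f x).mvfderiv, ModelWithCorners.range_eq_univ, fderivWithin_univ]
  rfl

theorem vectAct_leibniz (X : VectField n M) (f g : SmoothFun n M) :
    vectAct X (f * g) = f * vectAct X g + g * vectAct X f := by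
  ext x
  have h := DFunLike.congr_fun (mvfderiv_mul (mdiffAt f x) (mdiffAt g x)) (X x)
  exact h

theorem vectAct_add (X Y : VectField n M) : vectAct (X + Y) = vectAct X + vectAct Y := by
  ext f x
  exact map_add (mvfderiv (𝓡 n) f x) (X x) (Y x)

theorem vectAct_smul (c : ℝ) (X : VectField n M) : vectAct (c • X) = c • vectAct X := by
  ext f x
  exact map_smul (mvfderiv (𝓡 n) f x) c (X x)

theorem vectAct_zero : vectAct (0 : VectField n M) = 0 := by
  ext f x
  exact map_zero (mvfderiv (𝓡 n) f x)

variable (n M)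

/-- The Lie algebra `D¹(M) = Vect(M) ⊕ C^∞(M)` of linear differential operators of order at most
one on `C^∞(M)`: the operators `f ↦ X f + g f` with `X` a smooth vector field and `g` a smooth
function. The bracket is the commutator of operators. -/
def D1 : LieSubalgebra ℝ (Module.End ℝ (SmoothFun n M)) where
  carrier := {D | ∃ (X : VectField n M) (g : SmoothFun n M),
    D = vectAct X + LinearMap.mulLeft ℝ g}
  zero_mem' := ⟨0, 0, by rw [vectAct_zero]; ext; simp⟩
  add_mem' := by
    rintro _ _ ⟨X, g, rfl⟩ ⟨Y, h, rfl⟩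
    refine ⟨X + Y, g + h, ?_⟩
    rw [vectAct_add]
    ext f x
    simp
    ring
  smul_mem' := by
    rintro c _ ⟨X, g, rfl⟩
    refine ⟨c • X, c • g, ?_⟩
    rw [vectAct_smul]
    ext f x
    simp
  lie_mem' := by
    rintro _ _ ⟨X, g, rfl⟩ ⟨Y, h, rfl⟩
    refine ⟨bracket X Y, vectAct X h - vectAct Y g, ?_⟩
    rw [vectAct_bracket]
    ext f x
    simp only [LieRing.of_associative_ring_bracket, LinearMap.sub_apply, Module.End.mul_apply,
      LinearMap.add_apply, LinearMap.mulLeft_apply, map_add, vectAct_leibniz]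
    simp
    ring

variable {n M}

/-! De Rham cohomology in degree one. -/

/-- The `1`-form `α` read in the chart at `x₀`: the pullback of `α` along the inverse of the
chart. -/
def chartForm (α : OneForm n M) (x₀ : M) (y : EuclideanSpace ℝ (Fin n)) :
    EuclideanSpace ℝ (Fin n) →L[ℝ] ℝ :=
  (α ((extChartAt (𝓡 n) x₀).symm y)).comp
    (mfderiv 𝓘(ℝ, EuclideanSpace ℝ (Fin n)) (𝓡 n) (extChartAt (𝓡 n) x₀).symm y)

theorem contDiffAt_chartForm (α : OneForm n M) (x₀ : M) {y : EuclideanSpace ℝ (Fin n)}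
    (hy : y ∈ (extChartAt (𝓡 n) x₀).target) : ContDiffAt ℝ ∞ (chartForm α x₀) y := by
  have hs : (extChartAt (𝓡 n) x₀).symm y ∈ (chartAt (EuclideanSpace ℝ (Fin n)) x₀).source := by
    simpa using (extChartAt (𝓡 n) x₀).map_target hy
  have h := α.contMDiff ((extChartAt (𝓡 n) x₀).symm y)
  rw [Bundle.Trivialization.contMDiffAt_iff
    (e := trivializationAt (EuclideanSpace ℝ (Fin n) →L[ℝ] ℝ)
      (fun x : M => TangentSpace (𝓡 n) x →L[ℝ] Bundle.Trivial M ℝ x) x₀)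
    (by simpa using hs)] at h
  have hsymm := (contMDiffOn_extChartAt_symm (I := 𝓡 n) (n := ∞) x₀).contMDiffAt
    ((isOpen_extTarget x₀).mem_nhds hy)
  have h2 := (h.2.comp y hsymm).contDiffAt
  refine h2.congr_of_eventuallyEq ?_
  filter_upwards [(isOpen_extTarget x₀).mem_nhds hy] with z hz
  have hsz : (extChartAt (𝓡 n) x₀).symm z ∈ (chartAt (EuclideanSpace ℝ (Fin n)) x₀).source := by
    simpa using (extChartAt (𝓡 n) x₀).map_target hz
  have e := TangentBundle.symmL_trivializationAt (I := 𝓡 n) hsz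
  rw [(extChartAt (𝓡 n) x₀).right_inv hz, ModelWithCorners.range_eq_univ, mfderivWithin_univ] at e
  rw [Function.comp_apply, hom_trivializationAt_apply]
  simp only [ContinuousLinearMap.inCoordinates]
  rw [e]
  ext v
  simp [chartForm]

/-- The closed `1`-forms: in each chart, `(dα)(u, v) = (D_u α)(v) - (D_v α)(u)` vanishes. -/
def closedForms (n : ℕ) (M : Type*) [TopologicalSpace M]
    [ChartedSpace (EuclideanSpace ℝ (Fin n)) M] [IsManifold (𝓡 n) ∞ M] :
    Submodule ℝ (OneForm n M) where
  carrier := {α | ∀ x₀ : M, ∀ y ∈ (extChartAt (𝓡 n) x₀).target, ∀ u v,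
    fderiv ℝ (chartForm α x₀) y u v - fderiv ℝ (chartForm α x₀) y v u = 0}
  zero_mem' := by
    intro x₀ y hy u v
    have : chartForm (0 : OneForm n M) x₀ = fun _ => 0 := rfl
    simp [this]
  add_mem' := by
    intro α β hα hβ x₀ y hy u v
    have : chartForm (α + β) x₀ = chartForm α x₀ + chartForm β x₀ := rfl
    rw [this, fderiv_add ((contDiffAt_chartForm α x₀ hy).differentiableAt (by simp))
      ((contDiffAt_chartForm β x₀ hy).differentiableAt (by simp))]
    have h1 := hα x₀ y hy u v
    have h2 := hβ x₀ y hy u v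
    simp only [_root_.add_apply]
    linarith
  smul_mem' := by
    intro c α hα x₀ y hy u v
    have : chartForm (c • α) x₀ = c • chartForm α x₀ := rfl
    rw [this, fderiv_const_smul ((contDiffAt_chartForm α x₀ hy).differentiableAt (by simp))]
    have h1 := hα x₀ y hy u v
    simp only [_root_.smul_apply, ← smul_sub, h1, smul_zero]

/-- `d ∘ d = 0`: exact forms are closed. -/
theorem d_mem_closedForms (f : SmoothFun n M) : d f ∈ closedForms n M := by
  intro x₀ y hy u v
  have heq : chartForm (d f) x₀ =ᶠ[nhds y]
      fderiv ℝ (fun z => f ((extChartAt (𝓡 n) x₀).symm z)) := by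
    filter_upwards [(isOpen_extTarget x₀).mem_nhds hy] with z hz
    exact (fderiv_local f x₀ hz).symm
  rw [heq.fderiv_eq, sub_eq_zero]
  exact (contDiffAt_local f x₀ hy).isSymmSndFDerivAt (by simpa using two_le_infty) u v

variable (n M)

/-- The first de Rham cohomology `H¹_DR(M)`: closed `1`-forms modulo differentials of smooth
functions. -/
abbrev DeRhamH1 : Type _ :=
  closedForms n M ⧸ LinearMap.range (d.codRestrict (closedForms n M) d_mem_closedForms)

end Geometry

section ChevalleyEilenberg

open LieModule.Cohomology

variable (R L V : Type*) [CommRing R] [LieRing L] [LieAlgebra R L] [AddCommGroup V] [Module R V]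
  [LieRingModule L V] [LieModule R L V]

/-- The Chevalley–Eilenberg coboundary of `0`-cochains: `(d₀₁ v)(x) = x · v`. -/
def d₀₁ : V →ₗ[R] oneCochain R L V where
  toFun v :=
    { toFun := fun x => ⁅x, v⁆
      map_add' := fun x y => add_lie x y v
      map_smul' := fun c x => smul_lie c x v }
  map_add' v w := by ext x; simp
  map_smul' c v := by ext x; simp

theorem d₁₂_d₀₁ (v : V) : d₀₁ R L V v ∈ LinearMap.ker (d₁₂ R L V) := by
  rw [LinearMap.mem_ker]
  ext x y
  change ⁅x, ⁅y, v⁆⁆ - ⁅y, ⁅x, v⁆⁆ - ⁅⁅x, y⁆, v⁆ = 0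
  rw [lie_lie, sub_self]

/-- The first Chevalley–Eilenberg cohomology `H¹(L, V)`: `1`-cocycles modulo `1`-coboundaries. -/
abbrev CEH1 : Type _ :=
  LinearMap.ker (d₁₂ R L V) ⧸
    LinearMap.range ((d₀₁ R L V).codRestrict (LinearMap.ker (d₁₂ R L V)) (d₁₂_d₀₁ R L V))

end ChevalleyEilenberg

end DiffOp

end

/-!
Write `A = C^∞(M)`. The proof is algebraic once one has functions `f k` and vector fields `X k`,
finite in number, with `D = ∑ k, D (f k) X k` for every derivation `D` of `A`, with `X k (f l)`
symmetric in `k` and `l`, and with `∑ k, X k (f k)` invertible (`IsGradientFrame`).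

Such a frame comes from an immersion `M → ℝ^(2n+1)` and the gradients of its components for the
induced metric; the trace `∑ k, X k (f k)` is then `n`, which is where `n ≥ 1` enters. The immersion
(`exists_immersion`) is found among the maps whose components are combinations of cut-off chart
coordinates: a generic choice of countably many coefficients works, by Baire's theorem, because for
each compact piece the bad values of a single coefficient vector lie in a `C¹` image of a set of
dimension at most `2n`. Hadamard's lemma shows that derivations of `A` are vector fields and gives
the expansion in the frame (`IsFieldFrame.derivation_eq`), so that the Lie algebra of the theorem is
the semidirect product `Der A ⋉ A` (`IsFieldFrame.d1_eq_firstOrder`).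

Let `C` be a derivation of `Der A ⋉ A`.

* The centre of `Der A ⋉ A` consists of the constants, so `C 1` is a constant `κ`. Moreover `C`
  maps `A` to itself because `(g, h) ↦ (C g)₁ h` is an invariant symmetric biderivation, hence zero.
* The map `a ↦ C a - κ a` has commutators with derivations that are derivations, and kills `1`.
  It is itself a derivation (`IsGradientFrame.leibniz_of_commutator`). Subtracting the
  corresponding inner derivation leaves a map that is `κ` on `A` and a `1`-cocycle
  `γ : Der A → A` on `Der A`.
* A cocycle vanishes at a point on brackets of fields vanishing there, in particular on the fields
  `h² Z` with `h` vanishing at the point (`IsCocycle.eval_sq`). So `γ` is a first-order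
  differential operator, and its symbol is a constant multiple `c` of that of a divergence
  (`IsCocycle.exists_symbol`).
* The divergence of the frame, `D ↦ ∑ k, X k (D (f k))`, is a cocycle
  (`IsGradientFrame.isCocycle_divergence`). Then `γ - c div` is an `A`-linear cocycle, that is, a
  closed `1`-form (`IsFieldFrame.mem_closedForms_iff_isClosedForm`).

Conversely every triple of constants `κ`, `c` and closed form `θ` defines a derivation, and it is
inner exactly when `κ = c = 0` and `θ` is exact (`IsGradientFrame.eq_zero_of_pairOuter_eq`).
-/

namespace DiffOp

/-! ### First-order operators of a commutative algebra -/

section Algebra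

variable {A : Type*} [CommRing A] [Algebra ℝ A]

/-- A finite family of elements `f k` of `A` and of derivations `X k` such that every derivation
expands as `∑ k, D (f k) • X k`, the matrix `X k (f l)` is symmetric, and its trace is invertible.
For `A = C^∞(M)` it comes from an immersion `f : M → ℝ^ι`, with `X k` the gradient of `f k` for the
induced metric; the matrix is then the orthogonal projector onto the tangent space. -/
structure IsGradientFrame {ι : Type*} [Fintype ι] (f : ι → A) (X : ι → Derivation ℝ A A) :
    Prop where
  expand : ∀ D : Derivation ℝ A A, D = ∑ k, D (f k) • X k
  symm : ∀ k l, X k (f l) = X l (f k)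
  trace : IsUnit (∑ k, X k (f k))

variable {ι : Type*} [Fintype ι] {f : ι → A} {X : ι → Derivation ℝ A A}

theorem eq_zero_of_two_mul {a : A} (h : 2 * a = 0) : a = 0 := by
  have h2 : (2 : ℝ) • a = 0 := by rw [← h, two_smul, two_mul]
  simpa using h2

namespace IsGradientFrame

theorem exists_sum_mul (hf : IsGradientFrame f X) : ∃ b : ι → A, ∑ k, b k * X k (f k) = 1 := by
  obtain ⟨u, hu⟩ := hf.trace.exists_left_inv
  exact ⟨fun _ => u, by rw [← Finset.mul_sum, hu]⟩

/-- The squares of the diagonal entries `X k (f k)` also generate the unit ideal. -/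
theorem exists_sum_mul_sq (hf : IsGradientFrame f X) :
    ∃ b : ι → A, ∑ k, b k * X k (f k) ^ 2 = 1 := by
  obtain ⟨b, hb⟩ := hf.exists_sum_mul
  have h1 : Ideal.span (Set.range fun k => X k (f k)) = ⊤ := by
    rw [Ideal.eq_top_iff_one, ← hb]
    exact Ideal.sum_mem _ fun k _ => Ideal.mul_mem_left _ _ (Ideal.subset_span ⟨k, rfl⟩)
  have h2 := Ideal.span_pow_eq_top _ h1 2
  rw [← Set.range_comp, Ideal.eq_top_iff_one] at h2
  exact (Ideal.mem_span_range_iff_exists_fun).1 h2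

theorem eq_zero_of_forall_mul (hf : IsGradientFrame f X) {a : A}
    (h : ∀ k, X k (f k) * a = 0) : a = 0 := by
  obtain ⟨b, hb⟩ := hf.exists_sum_mul
  rw [← one_mul a, ← hb, Finset.sum_mul]
  exact Finset.sum_eq_zero fun k _ => by rw [mul_assoc, h, mul_zero]

theorem eq_zero_of_forall_sq_mul (hf : IsGradientFrame f X) {a : A}
    (h : ∀ k, X k (f k) ^ 2 * a = 0) : a = 0 := by
  obtain ⟨b, hb⟩ := hf.exists_sum_mul_sq
  rw [← one_mul a, ← hb, Finset.sum_mul]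
  exact Finset.sum_eq_zero fun k _ => by rw [mul_assoc, h, mul_zero]

/-- A linear map `T` with `T 1 = 0` whose commutator with every derivation is a derivation is
itself a derivation. The failure `δ h a = T (h a) - h T a - a T h` of the Leibniz rule is shown to
satisfy `Y g * δ h a + Y a * δ h g = 0` for all derivations `Y`. -/
theorem leibniz_of_commutator (hf : IsGradientFrame f X) (T : A →ₗ[ℝ] A) (hT1 : T 1 = 0)
    (hT : ∀ Y : Derivation ℝ A A, ∃ Z : Derivation ℝ A A, ∀ a, T (Y a) - Y (T a) = Z a) (h a : A) :
    T (h * a) = h * T a + a * T h := by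
  set δ : A → A := fun a => T (h * a) - h * T a - a * T h with hδ
  have hδadd : ∀ a b, δ (a + b) = δ a + δ b := fun a b => by
    simp only [hδ, mul_add, map_add]; ring
  have hδ1 : δ 1 = 0 := by simp [hδ, hT1]
  -- compare the commutators of `T` with `Y` and with `h • Y`
  have hder : ∀ Y : Derivation ℝ A A, ∃ Z : Derivation ℝ A A, ∀ a, δ (Y a) = Z a := by
    intro Y
    obtain ⟨Z₁, h₁⟩ := hT Y
    obtain ⟨Z₂, h₂⟩ := hT (h • Y)
    refine ⟨Z₂ - h • Z₁ - T h • Y, fun a => ?_⟩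
    have e₁ := h₁ a
    have e₂ := h₂ a
    simp only [Derivation.smul_apply, smul_eq_mul] at e₂
    simp only [hδ, Derivation.sub_apply, Derivation.smul_apply, smul_eq_mul, ← e₁, ← e₂]
    ring
  -- `η` measures the failure of `A`-linearity of `δ`; it turns out to be `η b u = u * δ b`
  set η : A → A → A := fun b u => δ (b * u) - b * δ u with hη
  have hηadd : ∀ b u v, η b (u + v) = η b u + η b v := fun b u v => by
    simp only [hη, mul_add, hδadd]; ring
  have hηsum : ∀ b (u : ι → A), η b (∑ k, u k) = ∑ k, η b (u k) := fun b u =>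
    map_sum (AddMonoidHom.mk' (η b) (hηadd b)) u _
  have hanti : ∀ (Y : Derivation ℝ A A) (k b c : A), η b (k * Y c) = -η c (k * Y b) := by
    intro Y k b c
    obtain ⟨Z, hZ⟩ := hder (k • Y)
    have e := hZ (b * c)
    rw [Derivation.leibniz, Derivation.leibniz, ← hZ, ← hZ] at e
    simp only [smul_eq_mul, hδadd] at e
    simp only [Derivation.smul_apply, smul_eq_mul] at e
    simp only [hη]
    linear_combination e
  have hlin₀ : ∀ (Y : Derivation ℝ A A) (k b c d : A),
      η c (b * (k * Y d)) = b * η c (k * Y d) := by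
    intro Y k b c d
    have e1 := hanti Y k d (b * c)
    rw [Derivation.leibniz] at e1
    have e2 : k * (b • Y c + c • Y b) = (k * b) * Y c + (k * c) * Y b := by
      simp only [smul_eq_mul]; ring
    rw [e2, hηadd, hanti Y (k * b) d c, hanti Y (k * c) d b] at e1
    have e3 : η (b * c) (k * Y d) = η b (k * c * Y d) + b * η c (k * Y d) := by
      simp only [hη]
      rw [show b * c * (k * Y d) = b * (k * c * Y d) by ring,
        show c * (k * Y d) = k * c * Y d by ring]
      ring
    rw [e3] at e1
    rw [show b * (k * Y d) = k * b * Y d by ring]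
    linear_combination -e1
  obtain ⟨β, hβ⟩ := hf.exists_sum_mul
  have hlin : ∀ c u, η c u = u * δ c := by
    intro c u
    have e : ∀ b, η c (b * 1) = b * η c 1 := fun b => by
      rw [← hβ, Finset.mul_sum, hηsum, hηsum, Finset.mul_sum]
      exact Finset.sum_congr rfl fun k _ => hlin₀ _ _ _ _ _
    rw [← mul_one u, e]
    simp only [hη, mul_one, hδ1, mul_zero, sub_zero]
  have hsym : ∀ (Y : Derivation ℝ A A) (b c : A), Y c * δ b + Y b * δ c = 0 := by
    intro Y b c
    have e := hanti Y 1 b c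
    rw [one_mul, one_mul, hlin, hlin] at e
    rw [e, neg_add_cancel]
  have hzero : δ a = 0 := by
    refine hf.eq_zero_of_forall_sq_mul fun k => ?_
    have e1 : X k (f k) * δ (f k) = 0 :=
      eq_zero_of_two_mul (by linear_combination hsym (X k) (f k) (f k))
    linear_combination X k (f k) * hsym (X k) a (f k) - X k a * e1
  linear_combination (hzero : T (h * a) - h * T a - a * T h = 0)

end IsGradientFrame

/-- A Chevalley–Eilenberg `1`-cocycle on `Der A` with values in `A`. -/
def IsCocycle (γ : Derivation ℝ A A →ₗ[ℝ] A) : Prop :=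
  ∀ P Q : Derivation ℝ A A, γ ⁅P, Q⁆ = P (γ Q) - Q (γ P)

theorem lie_smul_right (P Q : Derivation ℝ A A) (k : A) :
    ⁅P, k • Q⁆ = k • ⁅P, Q⁆ + P k • Q := by
  ext a
  simp only [Derivation.commutator_apply, Derivation.smul_apply, Derivation.add_apply, smul_eq_mul,
    Derivation.leibniz]
  ring

theorem lie_smul_left (P Q : Derivation ℝ A A) (k : A) :
    ⁅k • P, Q⁆ = k • ⁅P, Q⁆ - Q k • P := by
  ext a
  simp only [Derivation.commutator_apply, Derivation.smul_apply, Derivation.sub_apply, smul_eq_mul,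
    Derivation.leibniz]
  ring

namespace IsCocycle

variable {γ : Derivation ℝ A A →ₗ[ℝ] A}

/-- At a point `ε`, the cocycle vanishes on brackets of fields that vanish at `ε`. -/
theorem eval_lie (hγ : IsCocycle γ) (ε : A →ₐ[ℝ] ℝ) {h k : A} (hh : ε h = 0) (hk : ε k = 0)
    (P Q : Derivation ℝ A A) : ε (γ ⁅h • P, k • Q⁆) = 0 := by
  rw [hγ]
  simp [hh, hk]

/-- Fields of the form `h² Z` with `h` vanishing at `ε` are combinations of brackets of fields
vanishing at `ε`, by `v(g) w + w(g) v = [v, g w] + [w, g v]`. -/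
theorem eval_sq (hγ : IsCocycle γ) (hf : IsGradientFrame f X) (ε : A →ₐ[ℝ] ℝ) {h : A}
    (hh : ε h = 0) (Z : Derivation ℝ A A) : ε (γ ((h * h) • Z)) = 0 := by
  have h1 : ∀ (V W : Derivation ℝ A A) (g : A),
      ε (γ ((h * h) • (V g • W))) + ε (γ ((h * h) • (W g • V))) = 0 := by
    intro V W g
    have e : (h * h) • (V g • W) + (h * h) • (W g • V) =
        ⁅h • V, (g * h) • W⁆ + ⁅h • W, (g * h) • V⁆ := by
      ext a
      simp only [Derivation.commutator_apply, Derivation.smul_apply, Derivation.add_apply,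
        smul_eq_mul, Derivation.leibniz]
      ring
    rw [← map_add, ← map_add, e, map_add, map_add, hγ.eval_lie ε hh (by simp [hh]),
      hγ.eval_lie ε hh (by simp [hh]), add_zero]
  have h2 : ∀ (V : Derivation ℝ A A) (g a : A), ε (γ ((h * h) • ((a * V g) • V))) = 0 := by
    intro V g a
    have e := h1 V (a • V) g
    rw [smul_smul (V g) a V, mul_comm (V g) a, Derivation.smul_apply, smul_eq_mul] at e
    linarith
  have h3 : ∀ (V W : Derivation ℝ A A) (g : A), ε (γ ((h * h) • ((V g ^ 2) • W))) = 0 := by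
    intro V W g
    have e := h1 V (V g • W) g
    rw [Derivation.smul_apply, smul_eq_mul, mul_comm (V g) (W g), h2, smul_smul (V g), add_zero,
      ← sq (V g)] at e
    exact e
  obtain ⟨b, hb⟩ := hf.exists_sum_mul_sq
  have e : (h * h) • Z = ∑ k, (h * h) • ((X k (f k) ^ 2) • (b k • Z)) := by
    rw [← Finset.smul_sum]
    congr 1
    simp only [smul_smul]
    rw [← Finset.sum_smul]
    simp only [mul_comm _ (b _), hb, one_smul]
  rw [e, map_sum, map_sum]
  exact Finset.sum_eq_zero fun k _ => h3 _ _ _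

theorem eval_mul (hγ : IsCocycle γ) (hf : IsGradientFrame f X) (ε : A →ₐ[ℝ] ℝ) {h k : A}
    (hh : ε h = 0) (hk : ε k = 0) (Z : Derivation ℝ A A) : ε (γ ((h * k) • Z)) = 0 := by
  have e := hγ.eval_sq hf ε (h := h + k) (by simp [hh, hk]) Z
  have e1 : ((h + k) * (h + k)) • Z = (h * h) • Z + (k * k) • Z + ((h * k) • Z + (h * k) • Z) := by
    simp only [← add_smul]
    congr 1
    ring
  rw [e1] at e
  simp only [map_add, hγ.eval_sq hf ε hh, hγ.eval_sq hf ε hk] at e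
  linarith

/-- A cocycle is a differential operator of order at most one. -/
theorem second_difference (hγ : IsCocycle γ) (hf : IsGradientFrame f X)
    (hsep : ∀ a : A, (∀ ε : A →ₐ[ℝ] ℝ, ε a = 0) → a = 0) (h k : A) (Z : Derivation ℝ A A) :
    γ ((h * k) • Z) = h * γ (k • Z) + k * γ (h • Z) - h * k * γ Z := by
  rw [← sub_eq_zero]
  refine hsep _ fun ε => ?_
  have e := hγ.eval_mul hf ε (h := h - algebraMap ℝ A (ε h)) (k := k - algebraMap ℝ A (ε k))
    (by simp) (by simp) Z
  have e1 : ((h - algebraMap ℝ A (ε h)) * (k - algebraMap ℝ A (ε k))) • Z =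
      (h * k) • Z - (ε h) • (k • Z) - (ε k) • (h • Z) + (ε h * ε k) • Z := by
    ext a
    simp only [Derivation.smul_apply, Derivation.sub_apply, Derivation.add_apply, smul_eq_mul,
      Algebra.smul_def, map_mul]
    ring
  rw [e1] at e
  simp only [map_add, map_sub, map_smul, smul_eq_mul] at e
  simp only [map_sub, map_add, map_mul]
  linarith

/-- The symbol of a cocycle is a constant multiple of the symbol `(h, Z) ↦ Z h` of a divergence. -/
theorem exists_symbol (hγ : IsCocycle γ) (hf : IsGradientFrame f X)
    (hsep : ∀ a : A, (∀ ε : A →ₐ[ℝ] ℝ, ε a = 0) → a = 0)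
    (hconst : ∀ a : A, (∀ D : Derivation ℝ A A, D a = 0) → ∃ c : ℝ, a = algebraMap ℝ A c) :
    ∃ c : ℝ, ∀ (h : A) (Z : Derivation ℝ A A), γ (h • Z) = h * γ Z + c • Z h := by
  set σ : A → Derivation ℝ A A → A := fun h Z => γ (h • Z) - h * γ Z with hσ
  have hσmul : ∀ h k Z, σ (h * k) Z = k * σ h Z + h * σ k Z := by
    intro h k Z
    simp only [hσ, hγ.second_difference hf hsep]
    ring
  have hσlin : ∀ h k Z, σ h (k • Z) = k * σ h Z := by
    intro h k Z
    simp only [hσ, smul_smul, hγ.second_difference hf hsep]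
    ring
  have hσsub : ∀ h Y Z, σ h (Y - Z) = σ h Y - σ h Z := by
    intro h Y Z
    simp only [hσ, smul_sub, map_sub]
    ring
  -- `σ` is an invariant biderivation; comparing the invariance under `Y` and under `k • Y` shows
  -- that it is proportional to the pairing `(h, Z) ↦ Z h`
  have hinv : ∀ h (Y Z : Derivation ℝ A A), Y (σ h Z) = σ (Y h) Z + σ h ⁅Y, Z⁆ := by
    intro h Y Z
    have e1 := hγ Y (h • Z)
    have e2 := hγ Y Z
    rw [lie_smul_right, map_add] at e1
    simp only [hσ, map_sub, Derivation.leibniz, Derivation.smul_apply, smul_eq_mul] at e1 ⊢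
    linear_combination h * e2 - e1
  have hswap : ∀ h k (Y Z : Derivation ℝ A A), Y h * σ k Z = Z k * σ h Y := by
    intro h k Y Z
    have e1 := hinv h (k • Y) Z
    have e2 := hinv h Y Z
    rw [lie_smul_left, hσsub, hσlin, hσlin] at e1
    simp only [Derivation.smul_apply, smul_eq_mul, hσmul] at e1
    linear_combination k * e2 - e1
  obtain ⟨b, hb⟩ := hf.exists_sum_mul
  set c : A := ∑ k, b k * σ (f k) (X k) with hc
  have hσc : ∀ h Z, σ h Z = c * Z h := by
    intro h Z
    rw [← one_mul (σ h Z), ← hb, Finset.sum_mul, hc, Finset.sum_mul]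
    refine Finset.sum_congr rfl fun k _ => ?_
    linear_combination b k * hswap (f k) h (X k) Z
  obtain ⟨r, hr⟩ := hconst c fun D => by
    refine hf.eq_zero_of_forall_mul fun k => ?_
    have e := hinv (f k) D (X k)
    simp only [hσc, Derivation.leibniz, smul_eq_mul, Derivation.commutator_apply] at e
    linear_combination e
  refine ⟨r, fun h Z => ?_⟩
  have e := hσc h Z
  rw [hr] at e
  rw [Algebra.smul_def]
  linear_combination (e : γ (h • Z) - h * γ Z = _)

end IsCocycle

end Algebra

/-! ### The divergence of a gradient frame -/

section Divergence

variable {A : Type*} [CommRing A] [Algebra ℝ A]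
variable {ι : Type*} [Fintype ι] {f : ι → A} {X : ι → Derivation ℝ A A}

/-- The divergence of a derivation with respect to a gradient frame. For `C^∞(M)` this is the
Riemannian divergence of the metric `∑ k, (d f k)²`. -/
def divergence (f : ι → A) (X : ι → Derivation ℝ A A) : Derivation ℝ A A →ₗ[ℝ] A where
  toFun D := ∑ k, X k (D (f k))
  map_add' D E := by simp [Finset.sum_add_distrib]
  map_smul' c D := by simp [Finset.smul_sum]

theorem divergence_apply (D : Derivation ℝ A A) :
    divergence f X D = ∑ k, X k (D (f k)) := rfl

theorem derivation_sum_apply (Y : ι → Derivation ℝ A A) (a : A) :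
    (∑ k, Y k) a = ∑ k, Y k a := by
  have e := congrFun (map_sum (Derivation.coeFnAddMonoidHom (R := ℝ) (A := A) (M := A)) Y
    Finset.univ) a
  rwa [Finset.sum_apply] at e

namespace IsGradientFrame

theorem apply_eq (hf : IsGradientFrame f X) (D : Derivation ℝ A A) (a : A) :
    D a = ∑ k, D (f k) * X k a := by
  conv_lhs => rw [hf.expand D]
  rw [derivation_sum_apply]
  simp

theorem divergence_smul (hf : IsGradientFrame f X) (h : A) (D : Derivation ℝ A A) :
    divergence f X (h • D) = h * divergence f X D + D h := by
  simp only [divergence_apply, Derivation.smul_apply, smul_eq_mul, Derivation.leibniz,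
    Finset.sum_add_distrib, Finset.mul_sum]
  rw [hf.apply_eq D h]

/-- The second fundamental form computation behind the cocycle property of the divergence: with
`P` the projector `X i (f j)` and `D P` its entrywise derivative, the trace of `D P` against the
matrix `X i (E (f j))` is symmetric in `D` and `E`. -/
theorem trace_deriv_mul (hf : IsGradientFrame f X) (D E : Derivation ℝ A A) :
    ((Matrix.of fun i j => D (X i (f j))) * Matrix.of fun i j => X i (E (f j))).trace =
      ((Matrix.of fun i j => D (X i (f j))) * Matrix.of fun i j => E (X i (f j))).trace -
      ((Matrix.of fun i j => D (X i (f j))) * (Matrix.of fun i j => E (X i (f j))) *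
        Matrix.of fun i j => X i (f j)).trace := by
  set P : Matrix ι ι A := Matrix.of fun i j => X i (f j) with hP
  set DP : Matrix ι ι A := Matrix.of fun i j => D (X i (f j)) with hDP
  set EP : Matrix ι ι A := Matrix.of fun i j => E (X i (f j)) with hEP
  set Q : Matrix ι ι A := Matrix.of fun i j => X i (E (f j)) with hQ
  set V : ι → Derivation ℝ A A := fun j => ∑ k, E (f k) • ⁅X j, X k⁆ with hV
  set W : Matrix ι ι A := Matrix.of fun i j => V i (f j) with hW
  have hPDP : P * DP = DP - DP * P := by
    rw [eq_sub_iff_add_eq]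
    ext i j
    simp only [Matrix.add_apply, Matrix.mul_apply, hP, hDP, Matrix.of_apply]
    conv_rhs => rw [hf.apply_eq (X i) (f j), map_sum]
    simp only [Derivation.leibniz, smul_eq_mul, Finset.sum_add_distrib]
    congr 1
    exact Finset.sum_congr rfl fun k _ => mul_comm _ _
  have hPQ : P * Q = Q := by
    ext i j
    simp only [Matrix.mul_apply, hP, hQ, Matrix.of_apply]
    exact (hf.apply_eq (X i) (E (f j))).symm
  have hWP : W * P = W := by
    ext i j
    simp only [Matrix.mul_apply, hP, hW, Matrix.of_apply]
    exact (hf.apply_eq (V i) (f j)).symm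
  have hVapply : ∀ i a, V i a = ∑ k, E (f k) * (X i (X k a) - X k (X i a)) := by
    intro i a
    simp only [hV]
    rw [derivation_sum_apply]
    simp [Derivation.commutator_apply]
  have hQP : Q = Q * P + (EP + W) := by
    ext i j
    simp only [Matrix.add_apply, Matrix.mul_apply, hP, hQ, hEP, hW, Matrix.of_apply, hVapply]
    conv_lhs => rw [hf.apply_eq E (f j), map_sum]
    rw [hf.apply_eq E (X i (f j)), ← Finset.sum_add_distrib, ← Finset.sum_add_distrib]
    refine Finset.sum_congr rfl fun k _ => ?_
    simp only [Derivation.leibniz, smul_eq_mul]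
    ring
  have hPW : P * W = W + EP * P := by
    ext i j
    simp only [Matrix.add_apply, Matrix.mul_apply, hP, hEP, hW, Matrix.of_apply, hVapply,
      Finset.mul_sum]
    have e : ∀ k, X i (X k (f j)) - X k (X i (f j)) =
        ∑ l, (X i (f l) * (X l (X k (f j)) - X k (X l (f j))) - X k (X i (f l)) * X l (f j)) := by
      intro k
      conv_lhs => rw [hf.apply_eq (X i) (X k (f j)), hf.apply_eq (X i) (f j), map_sum,
        ← Finset.sum_sub_distrib]
      refine Finset.sum_congr rfl fun l _ => ?_
      simp only [Derivation.leibniz, smul_eq_mul]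
      ring
    have e2 : ∀ l, E (X i (f l)) = ∑ k, E (f k) * X k (X i (f l)) := fun l => hf.apply_eq E _
    simp only [e, e2, Finset.mul_sum, Finset.sum_mul]
    rw [Finset.sum_comm (f := fun l k => E (f k) * X k (X i (f l)) * X l (f j)),
      ← Finset.sum_add_distrib, Finset.sum_comm]
    refine Finset.sum_congr rfl fun k _ => ?_
    rw [← Finset.sum_add_distrib]
    refine Finset.sum_congr rfl fun l _ => ?_
    ring
  -- `P * DP * P = 0`, as for the derivative of any projector; this kills the two traces below
  have t1 : (DP * (Q * P)).trace = 0 := by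
    rw [← Matrix.mul_assoc, Matrix.trace_mul_comm, ← Matrix.mul_assoc, hPDP, Matrix.sub_mul,
      Matrix.mul_assoc DP P Q, hPQ, sub_self, Matrix.trace_zero]
  have t2 : (DP * (P * W)).trace = 0 := by
    have e : (DP * W).trace = (DP * W).trace - (DP * (P * W)).trace := by
      conv_lhs => rw [← hWP, ← Matrix.mul_assoc, Matrix.trace_mul_comm, ← Matrix.mul_assoc, hPDP,
        Matrix.sub_mul, Matrix.trace_sub, Matrix.mul_assoc DP P W]
    linear_combination e
  rw [hPW, Matrix.mul_add, Matrix.trace_add, ← Matrix.mul_assoc] at t2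
  rw [hQP, Matrix.mul_add, Matrix.trace_add, t1, Matrix.mul_add, Matrix.trace_add]
  linear_combination t2

theorem isCocycle_divergence (hf : IsGradientFrame f X) : IsCocycle (divergence f X) := by
  have key : ∀ D E : Derivation ℝ A A, ∑ k, ⁅D, X k⁆ (E (f k)) =
      ((Matrix.of fun i j => D (X i (f j))) * Matrix.of fun i j => X i (E (f j))).trace -
      ((Matrix.of fun i j => X i (D (f j))) * Matrix.of fun i j => X i (E (f j))).trace := by
    intro D E
    rw [← Matrix.trace_sub, ← Matrix.sub_mul]
    simp only [Matrix.trace, Matrix.diag, Matrix.mul_apply, Matrix.sub_apply, Matrix.of_apply]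
    refine Finset.sum_congr rfl fun i _ => ?_
    rw [hf.apply_eq]
    simp only [Derivation.commutator_apply]
  have hsymm : ∀ D : Derivation ℝ A A, (Matrix.of fun i j => D (X i (f j))).transpose =
      Matrix.of fun i j => D (X i (f j)) := by
    intro D
    ext i j
    simp only [Matrix.transpose_apply, Matrix.of_apply, hf.symm j i]
  have hsymm' : (Matrix.of fun i j => X i (f j)).transpose = Matrix.of fun i j => X i (f j) := by
    ext i j
    simp only [Matrix.transpose_apply, Matrix.of_apply, hf.symm j i]
  intro D E
  have e : D (divergence f X E) - E (divergence f X D) - divergence f X ⁅D, E⁆ =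
      ∑ k, ⁅D, X k⁆ (E (f k)) - ∑ k, ⁅E, X k⁆ (D (f k)) := by
    simp only [divergence_apply, map_sum, ← Finset.sum_sub_distrib, Derivation.commutator_apply,
      map_sub]
    exact Finset.sum_congr rfl fun k _ => by ring
  rw [key, key, hf.trace_deriv_mul D E, hf.trace_deriv_mul E D] at e
  have e1 := Matrix.trace_mul_comm (Matrix.of fun i j => X i (D (f j)))
    (Matrix.of fun i j => X i (E (f j)))
  have e2 := Matrix.trace_mul_comm (Matrix.of fun i j => D (X i (f j)))
    (Matrix.of fun i j => E (X i (f j)))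
  have e3 : ((Matrix.of fun i j => D (X i (f j))) * (Matrix.of fun i j => E (X i (f j))) *
        Matrix.of fun i j => X i (f j)).trace =
      ((Matrix.of fun i j => E (X i (f j))) * (Matrix.of fun i j => D (X i (f j))) *
        Matrix.of fun i j => X i (f j)).trace := by
    rw [← Matrix.trace_transpose, Matrix.transpose_mul, Matrix.transpose_mul, hsymm, hsymm, hsymm',
      Matrix.trace_mul_comm]
  linear_combination -e + e1 - e2 + e3

end IsGradientFrame

end Divergence

/-! ### Derivations of the Lie algebra of first-order operators -/

section Classification

variable {A : Type*} [CommRing A] [Algebra ℝ A]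

/-- The bracket of the semidirect product `Der A ⋉ A`, in terms of pairs. -/
def pairLie (x y : Derivation ℝ A A × A) : Derivation ℝ A A × A :=
  (⁅x.1, y.1⁆, x.1 y.2 - y.1 x.2)

variable {ι : Type*} [Fintype ι] {f : ι → A} {X : ι → Derivation ℝ A A}

/-- The closed algebraic `1`-forms: `A`-linear maps `θ : Der A → A` with
`θ [P, Q] = P (θ Q) - Q (θ P)`. -/
def IsClosedForm (θ : Derivation ℝ A A →ₗ[ℝ] A) : Prop :=
  IsCocycle θ ∧ ∀ (h : A) (P : Derivation ℝ A A), θ (h • P) = h * θ P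

/-- The derivation of `Der A ⋉ A` attached to two constants and a linear map `θ : Der A → A`. -/
def pairOuter (f : ι → A) (X : ι → Derivation ℝ A A) (κ c : ℝ) (θ : Derivation ℝ A A →ₗ[ℝ] A)
    (x : Derivation ℝ A A × A) : Derivation ℝ A A × A :=
  (0, κ • x.2 + c • divergence f X x.1 + θ x.1)

/-- A derivation of `Der A ⋉ A` is, modulo inner derivations, the sum of a multiple of the
projection to `A`, a multiple of the divergence, and a closed `A`-linear form on `Der A`. -/
theorem IsGradientFrame.exists_eq_pairOuter (hf : IsGradientFrame f X)
    (hsep : ∀ a : A, (∀ ε : A →ₐ[ℝ] ℝ, ε a = 0) → a = 0)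
    (hconst : ∀ a : A, (∀ D : Derivation ℝ A A, D a = 0) → ∃ c : ℝ, a = algebraMap ℝ A c)
    (C : Derivation ℝ A A × A →ₗ[ℝ] Derivation ℝ A A × A)
    (hC : ∀ x y, C (pairLie x y) = pairLie (C x) y + pairLie x (C y)) :
    ∃ (x₀ : Derivation ℝ A A × A) (κ c : ℝ) (θ : Derivation ℝ A A →ₗ[ℝ] A),
      IsClosedForm θ ∧ ∀ x, C x = pairLie x₀ x + pairOuter f X κ c θ x := by
  -- the central element `1` goes to a constant `κ`
  have hone : ∀ y, pairLie (C (0, 1)) y = 0 := by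
    intro y
    have e := hC (0, 1) y
    have e0 : ∀ z : Derivation ℝ A A × A, pairLie (0, 1) z = 0 := fun z => by simp [pairLie]
    rw [e0, e0, map_zero, add_zero] at e
    exact e.symm
  have hone₁ : (C (0, 1)).1 = 0 := by
    ext a
    simpa [pairLie] using congrArg Prod.snd (hone (0, a))
  obtain ⟨κ, hκ⟩ := hconst (C (0, 1)).2 fun D => by
    simpa [pairLie] using congrArg Prod.snd (hone (D, 0))
  -- `A` goes to `A`: the vector part defines an invariant symmetric biderivation, hence zero
  have hBsymm : ∀ g h, (C (0, g)).1 h = (C (0, h)).1 g := by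
    intro g h
    have e := congrArg Prod.snd (hC (0, g) (0, h))
    have e0 : pairLie ((0, g) : Derivation ℝ A A × A) (0, h) = 0 := by simp [pairLie]
    rw [e0, map_zero] at e
    simp only [pairLie, Prod.snd_zero, Prod.snd_add, Derivation.coe_zero, Pi.zero_apply] at e
    linear_combination -e
  have hact : ∀ (P : Derivation ℝ A A) g,
      C (0, P g) = pairLie (C (P, 0)) (0, g) + pairLie (P, 0) (C (0, g)) := by
    intro P g
    rw [← hC]
    simp [pairLie]
  have hBinv : ∀ (P : Derivation ℝ A A) g h,
      (C (0, P g)).1 h = P ((C (0, g)).1 h) - (C (0, g)).1 (P h) := by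
    intro P g h
    rw [hact]
    simp [pairLie, Derivation.commutator_apply]
  have hB : ∀ g, (C (0, g)).1 = 0 := by
    intro g
    ext a
    have e1 : ∀ P : Derivation ℝ A A, P a * (C (0, a)).1 g = 0 := by
      intro P
      refine eq_zero_of_two_mul ?_
      have e := hBinv (g • P) a a
      have e' := hBinv P a a
      rw [hBsymm] at e e'
      simp only [Derivation.smul_apply, smul_eq_mul, Derivation.leibniz] at e
      linear_combination e - g * e'
    have e2 := e1 (C (0, g)).1
    rw [hBsymm a g] at e2
    refine hsep _ fun ε => ?_
    have e3 := congrArg ε e2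
    rw [map_mul, map_zero] at e3
    exact mul_self_eq_zero.1 e3
  -- the scalar part of `C` on `A` is the multiplication by `κ` plus a derivation `P₀`
  set T : A →ₗ[ℝ] A := LinearMap.snd ℝ _ _ ∘ₗ C ∘ₗ LinearMap.inr ℝ _ _ - κ • LinearMap.id with hT
  have hTapply : ∀ a, T a = (C (0, a)).2 - κ • a := fun a => rfl
  have hT1 : T 1 = 0 := by
    rw [hTapply, hκ, Algebra.algebraMap_eq_smul_one, sub_self]
  have hTcomm : ∀ (P : Derivation ℝ A A) a, T (P a) - P (T a) = (C (P, 0)).1 a := by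
    intro P a
    rw [hTapply, hTapply, hact]
    simp [pairLie, hB]
  set P₀ : Derivation ℝ A A := Derivation.mk' T fun a b => by
    simpa using hf.leibniz_of_commutator T hT1 (fun Y => ⟨_, hTcomm Y⟩) a b
  have hP₀ : ∀ a, P₀ a = T a := fun a => rfl
  have hvect : ∀ P, (C (P, 0)).1 = ⁅P₀, P⁆ := by
    intro P
    ext a
    rw [Derivation.commutator_apply, hP₀, hP₀, hTcomm]
  -- the scalar part of `C` on derivations is a cocycle
  set γ : Derivation ℝ A A →ₗ[ℝ] A := LinearMap.snd ℝ _ _ ∘ₗ C ∘ₗ LinearMap.inl ℝ _ _ with hγdef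
  have hγapply : ∀ P, γ P = (C (P, 0)).2 := fun P => rfl
  have hγ : IsCocycle γ := by
    intro P Q
    have e := congrArg Prod.snd (hC (P, 0) (Q, 0))
    have e0 : pairLie ((P, 0) : Derivation ℝ A A × A) (Q, 0) = (⁅P, Q⁆, 0) := by simp [pairLie]
    rw [e0] at e
    rw [hγapply, e]
    simp only [pairLie, Prod.snd_add, map_zero, hγapply]
    ring
  obtain ⟨c, hc⟩ := hγ.exists_symbol hf hsep hconst
  refine ⟨(P₀, 0), κ, c, γ - c • divergence f X, ⟨fun P Q => ?_, fun h P => ?_⟩, ?_⟩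
  · simp only [LinearMap.sub_apply, LinearMap.smul_apply]
    rw [hγ, hf.isCocycle_divergence]
    simp only [map_sub, Derivation.map_smul, smul_sub]
    ring
  · simp only [LinearMap.sub_apply, LinearMap.smul_apply]
    rw [hc, hf.divergence_smul]
    simp only [Algebra.smul_def c]
    ring
  · rintro ⟨P, g⟩
    have e : C (P, g) = C (P, 0) + C (0, g) := by rw [← map_add]; simp
    rw [e]
    refine Prod.ext ?_ ?_
    · simp [hvect, hB, pairLie, pairOuter]
    · simp only [pairLie, pairOuter, Prod.snd_add, map_zero, sub_zero, hP₀, hTapply,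
        LinearMap.sub_apply, LinearMap.smul_apply, hγapply]
      ring

/-- Such a derivation is inner only if the two constants vanish and `θ` is exact. -/
theorem IsGradientFrame.eq_zero_of_pairOuter_eq [Nontrivial A] (hf : IsGradientFrame f X)
    {κ c : ℝ} {θ : Derivation ℝ A A →ₗ[ℝ] A}
    (hθ : IsClosedForm θ) {x₀ : Derivation ℝ A A × A}
    (h : ∀ x, pairOuter f X κ c θ x = pairLie x₀ x) :
    κ = 0 ∧ c = 0 ∧ ∃ g, ∀ P : Derivation ℝ A A, θ P = P g := by
  have h1 : ∀ g, κ • g = x₀.1 g := by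
    intro g
    simpa [pairOuter, pairLie] using congrArg Prod.snd (h (0, g))
  have hκ : κ = 0 := by
    have e := h1 1
    rw [Derivation.map_one_eq_zero] at e
    simpa using e
  have h2 : ∀ P : Derivation ℝ A A, c • divergence f X P + θ P = -P x₀.2 := by
    intro P
    simpa [pairOuter, pairLie] using congrArg Prod.snd (h (P, 0))
  have h3 : ∀ (P : Derivation ℝ A A) g, c • P g = 0 := by
    intro P g
    have e1 := h2 (g • P)
    have e2 := h2 P
    rw [hf.divergence_smul, hθ.2] at e1
    simp only [Algebra.smul_def, Derivation.smul_apply] at e1 e2 ⊢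
    linear_combination e1 - g * e2
  have hc : c = 0 := by
    have e : c • (1 : A) = 0 := by
      rw [← mul_one (c • (1 : A))]
      exact hf.eq_zero_of_forall_mul fun k => by
        rw [mul_one, mul_smul_comm, mul_one, h3]
    simpa using e
  refine ⟨hκ, hc, -x₀.2, fun P => ?_⟩
  have e := h2 P
  rw [hc, zero_smul, zero_add] at e
  rw [e, map_neg]

end Classification

/-! ### Cohomology of the Lie algebra of first-order operators -/

section FirstOrder

open LieModule.Cohomology

variable (A : Type*) [CommRing A] [Algebra ℝ A]

/-- The Lie algebra of first-order operators `a ↦ P a + g a` on a commutative algebra, with `P` a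
derivation. -/
def firstOrder : LieSubalgebra ℝ (Module.End ℝ A) where
  carrier := {D | ∃ (P : Derivation ℝ A A) (g : A),
    D = (P : A →ₗ[ℝ] A) + LinearMap.mulLeft ℝ g}
  zero_mem' := ⟨0, 0, by ext; simp⟩
  add_mem' := by
    rintro _ _ ⟨P, g, rfl⟩ ⟨Q, h, rfl⟩
    refine ⟨P + Q, g + h, ?_⟩
    ext a
    simp
    ring
  smul_mem' := by
    rintro c _ ⟨P, g, rfl⟩
    refine ⟨c • P, c • g, ?_⟩
    ext a
    simp
  lie_mem' := by
    rintro _ _ ⟨P, g, rfl⟩ ⟨Q, h, rfl⟩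
    refine ⟨⁅P, Q⁆, P h - Q g, ?_⟩
    ext a
    simp [LieRing.of_associative_ring_bracket]
    ring

/-- First-order operators as pairs of a derivation and a function. -/
noncomputable def firstOrderEquiv : (Derivation ℝ A A × A) ≃ₗ[ℝ] firstOrder A :=
  LinearEquiv.ofBijective
    { toFun := fun x => ⟨(x.1 : A →ₗ[ℝ] A) + LinearMap.mulLeft ℝ x.2, x.1, x.2, rfl⟩
      map_add' := fun x y => by
        ext a
        simp
        ring
      map_smul' := fun c x => by
        ext a
        simp }
    (by
      refine ⟨(injective_iff_map_eq_zero _).2 ?_, ?_⟩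
      · rintro ⟨P, g⟩ h
        have e : ∀ a, P a + g * a = 0 := fun a => by
          simpa using LinearMap.congr_fun (congrArg Subtype.val h) a
        have hg : g = 0 := by simpa using e 1
        refine Prod.ext ?_ hg
        ext a
        simpa [hg] using e a
      · rintro ⟨_, P, g, rfl⟩
        exact ⟨(P, g), rfl⟩)

variable {A}

theorem firstOrderEquiv_apply (x : Derivation ℝ A A × A) (a : A) :
    (firstOrderEquiv A x : Module.End ℝ A) a = x.1 a + x.2 * a := rfl

theorem firstOrderEquiv_pairLie (x y : Derivation ℝ A A × A) :
    firstOrderEquiv A (pairLie x y) = ⁅firstOrderEquiv A x, firstOrderEquiv A y⁆ := by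
  ext a
  rw [LieSubalgebra.coe_bracket, LieRing.of_associative_ring_bracket]
  simp only [LinearMap.sub_apply, Module.End.mul_apply, firstOrderEquiv_apply, pairLie,
    Derivation.commutator_apply, map_add, Derivation.leibniz, smul_eq_mul]
  ring

theorem pairLie_swap (x y : Derivation ℝ A A × A) : pairLie x y = -pairLie y x := by
  refine Prod.ext ?_ ?_
  · simp [pairLie]
  · simp [pairLie]

variable {ι : Type*} [Fintype ι] {f : ι → A} {X : ι → Derivation ℝ A A}
  {V : Type*} [AddCommGroup V] [Module ℝ V]

/-- The cochains of the Lie algebra of first-order operators attached to two constants and a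
form. -/
noncomputable def outerCochain (f : ι → A) (X : ι → Derivation ℝ A A)
    (Θ : V →ₗ[ℝ] Derivation ℝ A A →ₗ[ℝ] A) :
    ((ℝ × ℝ) × V) →ₗ[ℝ] oneCochain ℝ (firstOrder A) (firstOrder A) where
  toFun p := (firstOrderEquiv A).toLinearMap ∘ₗ
    LinearMap.inr ℝ _ _ ∘ₗ (p.1.1 • LinearMap.snd ℝ _ _ +
      (p.1.2 • divergence f X + Θ p.2) ∘ₗ LinearMap.fst ℝ _ _) ∘ₗ
        (firstOrderEquiv A).symm.toLinearMap
  map_add' p q := by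
    ext x a
    simp [firstOrderEquiv_apply, add_smul]
    ring
  map_smul' c p := by
    ext x a
    simp [firstOrderEquiv_apply]
    simp only [Algebra.smul_def, map_mul]
    ring

variable {Θ : V →ₗ[ℝ] Derivation ℝ A A →ₗ[ℝ] A}

theorem outerCochain_apply (p : (ℝ × ℝ) × V) (x : Derivation ℝ A A × A) :
    outerCochain f X Θ p (firstOrderEquiv A x) =
      firstOrderEquiv A (pairOuter f X p.1.1 p.1.2 (Θ p.2) x) := by
  simp [outerCochain, pairOuter, add_assoc]

theorem IsGradientFrame.lie_outerCochain (hf : IsGradientFrame f X)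
    (hΘ : ∀ v, IsClosedForm (Θ v)) (p : (ℝ × ℝ) × V) (x y : firstOrder A) :
    ⁅x, outerCochain f X Θ p y⁆ - ⁅y, outerCochain f X Θ p x⁆ - outerCochain f X Θ p ⁅x, y⁆ =
      0 := by
  obtain ⟨x, rfl⟩ := (firstOrderEquiv A).surjective x
  obtain ⟨y, rfl⟩ := (firstOrderEquiv A).surjective y
  have h1 := (hΘ p.2).1 x.1 y.1
  have h2 := hf.isCocycle_divergence x.1 y.1
  rw [← firstOrderEquiv_pairLie]
  simp only [outerCochain_apply]
  rw [← firstOrderEquiv_pairLie, ← firstOrderEquiv_pairLie, ← map_sub, ← map_sub,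
    LinearEquiv.map_eq_zero_iff]
  refine Prod.ext ?_ ?_
  · simp [pairLie, pairOuter]
  · simp only [pairLie, pairOuter, Prod.snd_sub, Derivation.coe_zero, Pi.zero_apply, map_add,
      Derivation.map_smul, h1, h2, Prod.snd_zero, smul_sub, sub_zero]
    ring

/-- Every `1`-cocycle is cohomologous to an outer one. -/
theorem IsGradientFrame.exists_outerCochain_sub (hf : IsGradientFrame f X)
    (hsep : ∀ a : A, (∀ ε : A →ₐ[ℝ] ℝ, ε a = 0) → a = 0)
    (hconst : ∀ a : A, (∀ D : Derivation ℝ A A, D a = 0) → ∃ c : ℝ, a = algebraMap ℝ A c)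
    (hΘ : ∀ θ, IsClosedForm θ → ∃ v, Θ v = θ) (C : oneCochain ℝ (firstOrder A) (firstOrder A))
    (hC : ∀ x y, ⁅x, C y⁆ - ⁅y, C x⁆ - C ⁅x, y⁆ = 0) :
    ∃ p x₀, ∀ y, ⁅y, x₀⁆ = outerCochain f X Θ p y - C y := by
  set C' : Derivation ℝ A A × A →ₗ[ℝ] Derivation ℝ A A × A :=
    (firstOrderEquiv A).symm.toLinearMap ∘ₗ C ∘ₗ (firstOrderEquiv A).toLinearMap with hC'
  have hC'apply : ∀ x, firstOrderEquiv A (C' x) = C (firstOrderEquiv A x) := fun x => by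
    simp [hC']
  obtain ⟨x₀, κ, c, θ, hθ, h⟩ := hf.exists_eq_pairOuter hsep hconst C' fun x y => by
    apply (firstOrderEquiv A).injective
    have e := hC (firstOrderEquiv A x) (firstOrderEquiv A y)
    rw [pairLie_swap (C' x) y, map_add, map_neg, hC'apply, firstOrderEquiv_pairLie,
      firstOrderEquiv_pairLie, firstOrderEquiv_pairLie, hC'apply, hC'apply]
    rw [sub_eq_zero] at e
    rw [← e]
    abel
  obtain ⟨v, rfl⟩ := hΘ θ hθ
  refine ⟨((κ, c), v), firstOrderEquiv A x₀, fun y => ?_⟩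
  obtain ⟨y, rfl⟩ := (firstOrderEquiv A).surjective y
  rw [outerCochain_apply, ← hC'apply, h, ← firstOrderEquiv_pairLie, ← map_sub,
    pairLie_swap x₀ y]
  congr 1
  abel

/-- The outer cocycles that are coboundaries. -/
theorem IsGradientFrame.outerCochain_eq_lie_iff [Nontrivial A] (hf : IsGradientFrame f X)
    {κ c : ℝ} {v : V} (hΘ : IsClosedForm (Θ v)) :
    (∃ x₀, ∀ y, ⁅y, x₀⁆ = outerCochain f X Θ ((κ, c), v) y) ↔
      κ = 0 ∧ c = 0 ∧ ∃ g, ∀ P : Derivation ℝ A A, Θ v P = P g := by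
  constructor
  · rintro ⟨x₀, hx₀⟩
    obtain ⟨x₀, rfl⟩ := (firstOrderEquiv A).surjective x₀
    refine hf.eq_zero_of_pairOuter_eq hΘ (x₀ := -x₀) fun x => ?_
    apply (firstOrderEquiv A).injective
    have e := hx₀ (firstOrderEquiv A x)
    rw [outerCochain_apply] at e
    rw [← e, ← firstOrderEquiv_pairLie, pairLie_swap x x₀]
    congr 1
    refine Prod.ext ?_ ?_
    · simp [pairLie]
    · simp [pairLie]
      ring
  · rintro ⟨rfl, rfl, g, hg⟩
    refine ⟨firstOrderEquiv A (0, g), fun y => ?_⟩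
    obtain ⟨y, rfl⟩ := (firstOrderEquiv A).surjective y
    rw [outerCochain_apply, ← firstOrderEquiv_pairLie]
    congr 1
    simp [pairLie, pairOuter, hg]

theorem nonempty_quotient_equiv {U K Q : Type*} [AddCommGroup U] [Module ℝ U] [AddCommGroup K]
    [Module ℝ K] [AddCommGroup Q] [Module ℝ Q] (Ψ : U →ₗ[ℝ] K) (B : Submodule ℝ K) (q : U →ₗ[ℝ] Q)
    (hq : Function.Surjective q) (hΨ : ∀ k, ∃ u, Ψ u - k ∈ B) (hker : ∀ u, Ψ u ∈ B ↔ q u = 0) :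
    Nonempty ((K ⧸ B) ≃ₗ[ℝ] Q) := by
  have hsurj : Function.Surjective (B.mkQ ∘ₗ Ψ) := by
    intro c
    obtain ⟨k, rfl⟩ := B.mkQ_surjective c
    obtain ⟨u, hu⟩ := hΨ k
    exact ⟨u, (Submodule.Quotient.eq B).2 hu⟩
  have hker' : LinearMap.ker (B.mkQ ∘ₗ Ψ) = LinearMap.ker q := by
    ext u
    rw [LinearMap.mem_ker, LinearMap.mem_ker, LinearMap.comp_apply, Submodule.mkQ_apply,
      Submodule.Quotient.mk_eq_zero, hker]
  exact ⟨(LinearMap.quotKerEquivOfSurjective _ hsurj).symm ≪≫ₗ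
    Submodule.quotEquivOfEq _ _ hker' ≪≫ₗ LinearMap.quotKerEquivOfSurjective _ hq⟩

/-- A criterion for the first adjoint cohomology: `ψ` parametrizes cocycles by `U`, reaches every
cohomology class, and `q` cuts out the coboundaries. -/
theorem nonempty_cohomology_equiv_of_cochains {L U Q : Type*} [LieRing L] [LieAlgebra ℝ L]
    [AddCommGroup U] [Module ℝ U] [AddCommGroup Q] [Module ℝ Q] (ψ : U →ₗ[ℝ] oneCochain ℝ L L)
    (q : U →ₗ[ℝ] Q) (hq : Function.Surjective q)
    (hψ : ∀ u x y, ⁅x, ψ u y⁆ - ⁅y, ψ u x⁆ - ψ u ⁅x, y⁆ = 0)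
    (hsurj : ∀ C : oneCochain ℝ L L, (∀ x y, ⁅x, C y⁆ - ⁅y, C x⁆ - C ⁅x, y⁆ = 0) →
      ∃ u x₀, ∀ y, ⁅y, x₀⁆ = ψ u y - C y)
    (hker : ∀ u, (∃ x₀, ∀ y, ⁅y, x₀⁆ = ψ u y) ↔ q u = 0) :
    Nonempty (CEH1 ℝ L L ≃ₗ[ℝ] Q) := by
  have hmem : ∀ u, ψ u ∈ LinearMap.ker (d₁₂ ℝ L L) := fun u =>
    LinearMap.mem_ker.2 (Subtype.ext (LinearMap.ext fun x => LinearMap.ext fun y => hψ u x y))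
  refine nonempty_quotient_equiv (ψ.codRestrict _ hmem) _ q hq ?_ fun u => ?_
  · rintro ⟨C, hC⟩
    obtain ⟨u, x₀, h⟩ := hsurj C fun x y => LinearMap.congr_fun (LinearMap.congr_fun
      (congrArg Subtype.val (LinearMap.mem_ker.1 hC)) x) y
    exact ⟨u, x₀, Subtype.ext (LinearMap.ext h)⟩
  · rw [← hker]
    constructor
    · rintro ⟨x₀, h⟩
      exact ⟨x₀, fun y => LinearMap.congr_fun (congrArg Subtype.val h) y⟩
    · rintro ⟨x₀, h⟩
      exact ⟨x₀, Subtype.ext (LinearMap.ext h)⟩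

/-- The first adjoint cohomology of the Lie algebra of first-order operators of an algebra that has
a gradient frame, enough points, and only constants killed by all derivations. The closed algebraic
forms are parametrized by a vector space `V`, in which `B₀` corresponds to the exact forms. -/
theorem IsGradientFrame.nonempty_cohomology_equiv [Nontrivial A] (hf : IsGradientFrame f X)
    (hsep : ∀ a : A, (∀ ε : A →ₐ[ℝ] ℝ, ε a = 0) → a = 0)
    (hconst : ∀ a : A, (∀ D : Derivation ℝ A A, D a = 0) → ∃ c : ℝ, a = algebraMap ℝ A c)
    (hΘ : ∀ θ, IsClosedForm θ ↔ ∃ v, Θ v = θ) (B₀ : Submodule ℝ V)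
    (hB₀ : ∀ v, v ∈ B₀ ↔ ∃ g, ∀ P : Derivation ℝ A A, Θ v P = P g) :
    Nonempty (CEH1 ℝ (firstOrder A) (firstOrder A) ≃ₗ[ℝ] ((ℝ × ℝ) × (V ⧸ B₀))) := by
  have hΘ' : ∀ v, IsClosedForm (Θ v) := fun v => (hΘ _).2 ⟨v, rfl⟩
  refine nonempty_cohomology_equiv_of_cochains (outerCochain f X Θ)
    (LinearMap.prodMap LinearMap.id B₀.mkQ)
    (Function.Surjective.prodMap Function.surjective_id (Submodule.mkQ_surjective _))
    (hf.lie_outerCochain hΘ') (hf.exists_outerCochain_sub hsep hconst fun θ hθ => (hΘ θ).1 hθ) ?_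
  rintro ⟨⟨κ, c⟩, v⟩
  have hq0 : LinearMap.prodMap LinearMap.id B₀.mkQ ((κ, c), v) = (0 : (ℝ × ℝ) × (V ⧸ B₀)) ↔
      κ = 0 ∧ c = 0 ∧ v ∈ B₀ := by
    simp [Prod.ext_iff, and_assoc]
  rw [hq0, hB₀, hf.outerCochain_eq_lie_iff (hΘ' v)]

end FirstOrder

/-! ### An immersion into a Euclidean space -/

section Immersion

open Set Filter Topology Module

variable {n : ℕ}

/-- The differential of the map `y ↦ ∑ i ∈ s, ∑ j, (h i y) j • t (i, j)`, with coefficients `t` in a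
vector space `W`, as a function of the pair `z = (y, v)` of a point and a vector. -/
noncomputable def coefDeriv {ι W : Type*} [NormedAddCommGroup W] [NormedSpace ℝ W] (s : Finset ι)
    (h : ι → EuclideanSpace ℝ (Fin n) → EuclideanSpace ℝ (Fin n)) (t : ι × Fin n → W)
    (z : EuclideanSpace ℝ (Fin n) × EuclideanSpace ℝ (Fin n)) : W :=
  ∑ i ∈ s, ∑ j, (fderiv ℝ (h i) z.1 z.2) j • t (i, j)

section coefDeriv

variable {ι W : Type*} [NormedAddCommGroup W] [NormedSpace ℝ W] {s : Finset ι}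
  {h : ι → EuclideanSpace ℝ (Fin n) → EuclideanSpace ℝ (Fin n)}
  {B : Set (EuclideanSpace ℝ (Fin n))}

theorem contDiffOn_fderiv_apply (hB : IsOpen B) {k : EuclideanSpace ℝ (Fin n) →
    EuclideanSpace ℝ (Fin n)} (hk : ContDiffOn ℝ ∞ k B) :
    ContDiffOn ℝ 1 (fun z : EuclideanSpace ℝ (Fin n) × EuclideanSpace ℝ (Fin n) =>
      fderiv ℝ k z.1 z.2) (B ×ˢ univ) := by
  have h1 : ContDiffOn ℝ 1 (fderiv ℝ k) B :=
    hk.fderiv_of_isOpen hB (by rw [one_add_one_eq_two]; exact two_le_infty)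
  exact (h1.comp contDiff_fst.contDiffOn fun z hz => hz.1).clm_apply contDiff_snd.contDiffOn

theorem contDiffOn_coefDeriv (hB : IsOpen B) (hh : ∀ i ∈ s, ContDiffOn ℝ ∞ (h i) B)
    (t : ι × Fin n → W) : ContDiffOn ℝ 1 (coefDeriv s h t) (B ×ˢ univ) := by
  refine ContDiffOn.sum fun i hi => ContDiffOn.sum fun j _ => ?_
  have h1 := contDiffOn_fderiv_apply hB (hh i hi)
  exact ((contDiffOn_euclidean.1 h1) j).smul contDiffOn_const

theorem continuousOn_coefDeriv (hB : IsOpen B) (hh : ∀ i ∈ s, ContDiffOn ℝ ∞ (h i) B) :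
    ContinuousOn (fun q : (ι × Fin n → W) × _ => coefDeriv s h q.1 q.2)
      (univ ×ˢ (B ×ˢ univ)) := by
  refine continuousOn_finsetSum _ fun i hi => continuousOn_finsetSum _ fun j _ => ?_
  have h1 := ((contDiffOn_euclidean.1 (contDiffOn_fderiv_apply hB (hh i hi))) j).continuousOn
  refine (h1.comp continuousOn_snd fun q hq => hq.2).smul ?_
  exact ((continuous_apply (i, j)).comp continuous_fst).continuousOn

theorem isOpen_coefDeriv_ne_zero (hB : IsOpen B) (hh : ∀ i ∈ s, ContDiffOn ℝ ∞ (h i) B)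
    {K : Set (EuclideanSpace ℝ (Fin n) × EuclideanSpace ℝ (Fin n))} (hK : IsCompact K)
    (hKB : K ⊆ B ×ˢ univ) :
    IsOpen {t : ι × Fin n → W | ∀ z ∈ K, coefDeriv s h t z ≠ 0} := by
  rw [isOpen_iff_mem_nhds]
  intro t ht
  refine hK.eventually_forall_of_forall_eventually fun z hz => ?_
  have hopen : IsOpen ((univ : Set (ι × Fin n → W)) ×ˢ
      (B ×ˢ (univ : Set (EuclideanSpace ℝ (Fin n))))) := isOpen_univ.prod (hB.prod isOpen_univ)
  have hc := (continuousOn_coefDeriv (W := W) hB hh).continuousAt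
    (hopen.mem_nhds (show (t, z) ∈ _ from ⟨mem_univ _, hKB hz⟩))
  exact hc.eventually_ne (ht z hz)

theorem coefDeriv_update [DecidableEq ι] {i₀ : ι} (hi₀ : i₀ ∈ s) {j₀ : Fin n}
    (t : ι × Fin n → W) (w : W) {z : EuclideanSpace ℝ (Fin n) × EuclideanSpace ℝ (Fin n)}
    (hz : fderiv ℝ (h i₀) z.1 z.2 = z.2) :
    coefDeriv s h (Function.update t (i₀, j₀) w) z =
      coefDeriv s h (Function.update t (i₀, j₀) 0) z + z.2 j₀ • w := by
  have e : ∀ i j, (fderiv ℝ (h i) z.1 z.2) j • Function.update t (i₀, j₀) w (i, j) =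
      (fderiv ℝ (h i) z.1 z.2) j • Function.update t (i₀, j₀) 0 (i, j) +
        (if i = i₀ then (if j = j₀ then z.2 j₀ • w else 0) else 0) := by
    intro i j
    by_cases hi : i = i₀
    · subst hi
      by_cases hj : j = j₀
      · subst hj
        simp [hz]
      · simp [Function.update_of_ne, hj]
    · simp [Function.update_of_ne, hi]
  simp only [coefDeriv, e, Finset.sum_add_distrib]
  simp [hi₀]

/-- For fixed values of the other coefficients, the values of the coefficient `t (i₀, j₀)` at which
some pair `(y, v)` in `K` is killed form the image of `K` under a `C¹` map of `2 n` variables. -/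
theorem dense_coefDeriv_ne_zero [FiniteDimensional ℝ W] (hW : 2 * n < finrank ℝ W)
    (hB : IsOpen B) (hBc : Convex ℝ B) (hh : ∀ i ∈ s, ContDiffOn ℝ ∞ (h i) B) {i₀ : ι}
    (hi₀ : i₀ ∈ s) (hid : EqOn (h i₀) id B) (j₀ : Fin n)
    {K : Set (EuclideanSpace ℝ (Fin n) × EuclideanSpace ℝ (Fin n))} (hKB : K ⊆ B ×ˢ univ)
    (hK : ∀ z ∈ K, z.2 j₀ = 1) :
    Dense {t : ι × Fin n → W | ∀ z ∈ K, coefDeriv s h t z ≠ 0} := by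
  classical
  intro t
  set Φ := fun z => -coefDeriv s h (Function.update t (i₀, j₀) 0) z with hΦ
  have hdense : Dense (Φ '' K)ᶜ := by
    refine ContDiffOn.dense_compl_image_of_dimH_lt_finrank
      (contDiffOn_coefDeriv hB hh _).neg (hBc.prod convex_univ) hKB ?_
    refine (dimH_mono (subset_univ K)).trans_lt ?_
    rw [Real.dimH_univ_eq_finrank, finrank_prod, finrank_euclideanSpace_fin, ← two_mul]
    exact_mod_cast hW
  have hcont : Continuous fun w : W => Function.update t (i₀, j₀) w :=
    continuous_const.update _ continuous_id
  have h1 := map_mem_closure hcont (hdense (t (i₀, j₀)))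
    (t := {t : ι × Fin n → W | ∀ z ∈ K, coefDeriv s h t z ≠ 0}) ?_
  · rwa [Function.update_eq_self] at h1
  · intro w hw z hz h0
    have hfd : fderiv ℝ (h i₀) z.1 z.2 = z.2 := by
      have e : h i₀ =ᶠ[𝓝 z.1] id := hid.eventuallyEq_of_mem (hB.mem_nhds (hKB hz).1)
      rw [e.fderiv_eq, fderiv_id]
      rfl
    rw [coefDeriv_update hi₀ t w hfd, hK z hz, one_smul] at h0
    exact hw ⟨z, hz, neg_eq_of_add_eq_zero_right h0⟩

end coefDeriv

variable {M : Type*} [TopologicalSpace M] [ChartedSpace (EuclideanSpace ℝ (Fin n)) M]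
  [IsManifold (𝓡 n) ∞ M]

/-- The map `M → W` with coefficients `t` in the cut-off chart coordinates of a bump covering. -/
noncomputable def coefMap {ι W : Type*} [NormedAddCommGroup W] [NormedSpace ℝ W]
    (φ : SmoothBumpCovering ι (𝓡 n) M) (t : ι × Fin n → W) (x : M) : W :=
  ∑ᶠ i, ∑ j, (φ i x • extChartAt (𝓡 n) (φ.c i) x) j • t (i, j)

section coefMap

variable [T2Space M] {ι W : Type*} [NormedAddCommGroup W] [NormedSpace ℝ W]
  (φ : SmoothBumpCovering ι (𝓡 n) M)

theorem contMDiff_bump_smul_chart (i : ι) :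
    ContMDiff (𝓡 n) 𝓘(ℝ, EuclideanSpace ℝ (Fin n)) ∞
      fun x => φ i x • extChartAt (𝓡 n) (φ.c i) x :=
  (φ i).contMDiff_smul contMDiffOn_extChartAt

theorem contMDiff_coefMap (t : ι × Fin n → W) : ContMDiff (𝓡 n) 𝓘(ℝ, W) ∞ (coefMap φ t) := by
  refine contMDiff_finsum (fun i => ?_) (φ.locallyFinite.subset fun i => ?_)
  · set L : EuclideanSpace ℝ (Fin n) →L[ℝ] W :=
      ∑ j, (EuclideanSpace.proj j : EuclideanSpace ℝ (Fin n) →L[ℝ] ℝ).smulRight (t (i, j)) with hL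
    have e : (fun x => ∑ j, (φ i x • extChartAt (𝓡 n) (φ.c i) x) j • t (i, j)) =
        fun x => L (φ i x • extChartAt (𝓡 n) (φ.c i) x) := by
      ext x
      simp [hL, mul_smul, Finset.smul_sum]
    rw [e]
    exact L.contMDiff.comp (contMDiff_bump_smul_chart φ i)
  · rw [Function.support_subset_iff']
    intro x hx
    simp [Function.notMem_support.1 hx]

/-- Near every point, the maps `coefMap φ t` for which some nonzero tangent vector is killed are
excluded by countably many open dense conditions on `t`. -/
theorem exists_dense_coefMap [FiniteDimensional ℝ W] (hW : 2 * n < finrank ℝ W) (p : M) :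
    ∃ U ∈ 𝓝 p, ∃ O : Fin n × ℕ → Set (ι × Fin n → W), (∀ a, IsOpen (O a)) ∧ (∀ a, Dense (O a)) ∧
      ∀ t ∈ ⋂ a, O a, ∀ x ∈ U, Function.Injective (mfderiv (𝓡 n) 𝓘(ℝ, W) (coefMap φ t) x) := by
  classical
  set i₀ := φ.ind p (mem_univ p) with hi₀
  set ψ := extChartAt (𝓡 n) (φ.c i₀) with hψ
  have hp : p ∈ ψ.source := φ.mem_extChartAt_ind_source p (mem_univ p)
  -- only the bump functions with index in `s` matter near `p`
  obtain ⟨U₁, hU₁, hfin⟩ := φ.locallyFinite p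
  set s : Finset ι := insert i₀ hfin.toFinset with hs
  have hsupp : ∀ x ∈ U₁, ∀ i, i ∉ s → φ i x = 0 := by
    intro x hx i hi
    by_contra h0
    exact hi (Finset.mem_insert_of_mem (hfin.mem_toFinset.2 ⟨x, h0, hx⟩))
  have hnear : {x | φ i₀ x = 1} ∩ U₁ ∈ 𝓝 p :=
    inter_mem (φ.eventuallyEq_one p (mem_univ p)) hU₁
  have hcont : ContinuousAt ψ.symm (ψ p) := continuousAt_extChartAt_symm' hp
  have hnear' : ψ.target ∩ ψ.symm ⁻¹' ({x | φ i₀ x = 1} ∩ U₁) ∈ 𝓝 (ψ p) := by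
    refine inter_mem ((isOpen_extTarget _).mem_nhds (ψ.map_source hp)) (hcont ?_)
    rwa [ψ.left_inv hp]
  obtain ⟨R, hR, hRsub⟩ := Metric.mem_nhds_iff.1 hnear'
  set B := Metric.ball (ψ p) R with hB
  set h : ι → EuclideanSpace ℝ (Fin n) → EuclideanSpace ℝ (Fin n) :=
    fun i y => φ i (ψ.symm y) • extChartAt (𝓡 n) (φ.c i) (ψ.symm y) with hh
  have hsymm : ContMDiffOn 𝓘(ℝ, EuclideanSpace ℝ (Fin n)) (𝓡 n) ∞ ψ.symm B :=
    (contMDiffOn_extChartAt_symm (φ.c i₀)).mono fun y hy => (hRsub hy).1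
  have hhsmooth : ∀ i ∈ s, ContDiffOn ℝ ∞ (h i) B := fun i _ =>
    ((contMDiff_bump_smul_chart φ i).comp_contMDiffOn hsymm).contDiffOn
  have hid : EqOn (h i₀) id B := by
    intro y hy
    have h1 : φ i₀ (ψ.symm y) = 1 := (hRsub hy).2.1
    simp only [hh, h1, one_smul, id]
    exact ψ.right_inv (hRsub hy).1
  set K : Fin n × ℕ → Set (EuclideanSpace ℝ (Fin n) × EuclideanSpace ℝ (Fin n)) := fun a =>
    Metric.closedBall (ψ p) (R / 2) ×ˢ (Metric.closedBall 0 a.2 ∩ {v | v a.1 = 1}) with hK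
  have hKB : ∀ a, K a ⊆ B ×ˢ univ := fun a z hz =>
    ⟨Metric.closedBall_subset_ball (by linarith) hz.1, mem_univ _⟩
  have hKc : ∀ a, IsCompact (K a) := by
    intro a
    refine (isCompact_closedBall _ _).prod ((isCompact_closedBall _ _).inter_right ?_)
    exact isClosed_eq (EuclideanSpace.proj a.1 : EuclideanSpace ℝ (Fin n) →L[ℝ] ℝ).continuous
      continuous_const
  refine ⟨ψ.source ∩ ψ ⁻¹' Metric.ball (ψ p) (R / 2), ?_,
    fun a => {t | ∀ z ∈ K a, coefDeriv s h t z ≠ 0},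
    fun a => isOpen_coefDeriv_ne_zero Metric.isOpen_ball hhsmooth (hKc a) (hKB a),
    fun a => dense_coefDeriv_ne_zero hW Metric.isOpen_ball (convex_ball _ _) hhsmooth
      (Finset.mem_insert_self _ _) hid a.1 (hKB a) fun z hz => hz.2.2, ?_⟩
  · exact inter_mem (extChartAt_source_mem_nhds' hp)
      ((continuousAt_extChartAt' hp) (Metric.ball_mem_nhds _ (by linarith)))
  · rintro t ht x ⟨hx, hxB⟩
    have hy : ψ x ∈ B := Metric.ball_subset_ball (by linarith) hxB
    have hG : ∀ y ∈ B, coefMap φ t (ψ.symm y) = ∑ i ∈ s, ∑ j, (h i y) j • t (i, j) := by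
      intro y hy
      refine finsum_eq_sum_of_support_subset _ fun i hi => ?_
      by_contra his
      have h1 := hsupp _ (hRsub hy).2.2 i his
      exact hi (by simp [h1])
    have hfd : ∀ v, fderiv ℝ (fun y => coefMap φ t (ψ.symm y)) (ψ x) v =
        coefDeriv s h t (ψ x, v) := by
      intro v
      have e : (fun y => coefMap φ t (ψ.symm y)) =ᶠ[𝓝 (ψ x)]
          fun y => ∑ i ∈ s, ∑ j, (h i y) j • t (i, j) :=
        (show EqOn _ _ B from hG).eventuallyEq_of_mem (Metric.isOpen_ball.mem_nhds hy)
      rw [e.fderiv_eq]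
      have hd : ∀ i ∈ s, ∀ j, HasFDerivAt (fun y => (h i y) j • t (i, j))
          ((((EuclideanSpace.proj j : EuclideanSpace ℝ (Fin n) →L[ℝ] ℝ).comp
            (fderiv ℝ (h i) (ψ x)))).smulRight (t (i, j))) (ψ x) := by
        intro i hi j
        have h1 := (((hhsmooth i hi).contDiffAt (Metric.isOpen_ball.mem_nhds hy)).differentiableAt
          (by simp)).hasFDerivAt
        exact (((EuclideanSpace.proj j : EuclideanSpace ℝ (Fin n) →L[ℝ] ℝ).hasFDerivAt).comp _
          h1).smul_const _
      rw [(HasFDerivAt.fun_sum fun i hi => HasFDerivAt.fun_sum fun j _ => hd i hi j).fderiv]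
      simp [coefDeriv]
    rw [injective_iff_map_eq_zero]
    intro v hv
    by_contra hv0
    have hinv := isInvertible_mfderiv_extChartAt (I := 𝓡 n) hx
    set w : EuclideanSpace ℝ (Fin n) :=
      mfderiv (𝓡 n) 𝓘(ℝ, EuclideanSpace ℝ (Fin n)) ψ x v with hw
    have hw0 : w ≠ 0 := by
      intro h0
      exact hv0 (hinv.injective (h0.trans (map_zero _).symm))
    have hcomp : coefDeriv s h t (ψ x, w) = 0 := by
      rw [← hfd]
      refine Eq.trans ?_ hv
      have hdiff : MDifferentiableAt 𝓘(ℝ, EuclideanSpace ℝ (Fin n)) 𝓘(ℝ, W)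
          (fun y => coefMap φ t (ψ.symm y)) (ψ x) :=
        ((contMDiff_coefMap φ t).contMDiffAt.comp _
          (hsymm.contMDiffAt (Metric.isOpen_ball.mem_nhds hy))).mdifferentiableAt (by simp)
      have hψd : MDifferentiableAt (𝓡 n) 𝓘(ℝ, EuclideanSpace ℝ (Fin n)) ψ x :=
        mdifferentiableAt_extChartAt (by simpa [hψ] using hx)
      have e : coefMap φ t =ᶠ[𝓝 x] (fun y => coefMap φ t (ψ.symm y)) ∘ ψ := by
        filter_upwards [extChartAt_source_mem_nhds' hx] with z hz
        rw [Function.comp_apply, ψ.left_inv hz]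
      rw [e.mfderiv_eq, mfderiv_comp x hdiff hψd, mfderiv_eq_fderiv]
      rfl
    -- rescale `w` to have a coordinate equal to `1`, as the compact sets `K` require
    obtain ⟨j, hj⟩ : ∃ j, w j ≠ 0 := by
      by_contra! h0
      exact hw0 (by ext j; exact h0 j)
    obtain ⟨m, hm⟩ := exists_nat_ge ‖(w j)⁻¹ • w‖
    refine mem_iInter.1 ht (j, m) (ψ x, (w j)⁻¹ • w) ⟨Metric.ball_subset_closedBall hxB, ?_, ?_⟩ ?_
    · simpa using hm
    · simp [hj]
    · have e : coefDeriv s h t (ψ x, (w j)⁻¹ • w) = (w j)⁻¹ • coefDeriv s h t (ψ x, w) := by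
        rw [← hfd, ← hfd, map_smul]
      rw [e, hcomp, smul_zero]

end coefMap

/-- A weak form of Whitney's immersion theorem, without compactness: by Baire's theorem a generic
choice of coefficients gives an immersion into `ℝ^(2n+1)`. -/
theorem exists_immersion (n : ℕ) (M : Type*) [TopologicalSpace M]
    [ChartedSpace (EuclideanSpace ℝ (Fin n)) M] [IsManifold (𝓡 n) ∞ M] [T2Space M]
    [SecondCountableTopology M] :
    ∃ F : M → EuclideanSpace ℝ (Fin (2 * n + 1)),
      ContMDiff (𝓡 n) 𝓘(ℝ, EuclideanSpace ℝ (Fin (2 * n + 1))) ∞ F ∧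
      ∀ x, Function.Injective (mfderiv (𝓡 n) 𝓘(ℝ, EuclideanSpace ℝ (Fin (2 * n + 1))) F x) := by
  have : LocallyCompactSpace M := ChartedSpace.locallyCompactSpace (EuclideanSpace ℝ (Fin n)) M
  obtain ⟨ι, φ, -⟩ := SmoothBumpCovering.exists_isSubordinate (𝓡 n) (isClosed_univ (X := M))
    fun x _ => univ_mem
  have hι : Countable ι := Set.countable_univ_iff.1
    (φ.locallyFinite.countable_univ fun i => (φ i).nonempty_support)
  have hW : 2 * n < finrank ℝ (EuclideanSpace ℝ (Fin (2 * n + 1))) := by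
    rw [finrank_euclideanSpace_fin]
    exact Nat.lt_succ_self _
  choose U hU O hO hOd hinj using
    exists_dense_coefMap (W := EuclideanSpace ℝ (Fin (2 * n + 1))) φ hW
  obtain ⟨S, hS, hSU⟩ := TopologicalSpace.countable_cover_nhds hU
  have hdense : Dense (⋂ p ∈ S, ⋂ a, O p a) := by
    refine dense_biInter_of_Gδ (fun p _ => .iInter_of_isOpen (hO p)) hS fun p _ =>
      dense_iInter_of_isOpen (hO p) (hOd p)
  obtain ⟨t, ht⟩ := hdense.nonempty
  refine ⟨coefMap φ t, contMDiff_coefMap φ t, fun x => ?_⟩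
  have hx : x ∈ ⋃ p ∈ S, U p := by rw [hSU]; exact mem_univ x
  obtain ⟨p, hp, hxp⟩ := mem_iUnion₂.1 hx
  exact hinj p t (mem_iInter₂.1 ht p hp) x hxp

end Immersion

/-! ### Pseudo-inverses and gradient fields -/

section GradInv

variable {E W : Type*} [NormedAddCommGroup E] [InnerProductSpace ℝ E] [FiniteDimensional ℝ E]
  [NormedAddCommGroup W] [InnerProductSpace ℝ W] [CompleteSpace W]

/-- The pseudo-inverse `(A† A)⁻¹ A†` of a linear map. When `A` is the differential of an immersion
into a Euclidean space, it sends the basis vectors to the gradients of the components. -/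
noncomputable def gradInv (A : E →L[ℝ] W) : W →L[ℝ] E :=
  haveI := FiniteDimensional.complete ℝ E
  (A.adjoint.comp A).inverse.comp A.adjoint

variable [CompleteSpace E] {A : E →L[ℝ] W}

theorem isInvertible_adjoint_comp (hA : Function.Injective A) :
    (A.adjoint.comp A).IsInvertible := by
  have hinj : Function.Injective (A.adjoint.comp A) := by
    rw [injective_iff_map_eq_zero]
    intro v hv
    have h1 : inner ℝ (A v) (A v) = 0 := by
      rw [← ContinuousLinearMap.adjoint_inner_left]
      have hv' : A.adjoint (A v) = 0 := hv
      rw [hv', inner_zero_left]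
    exact hA ((inner_self_eq_zero.1 h1).trans (map_zero A).symm)
  exact ⟨(LinearEquiv.ofInjectiveEndo (A.adjoint.comp A : E →ₗ[ℝ] E)
    hinj).toContinuousLinearEquiv, by ext v; rfl⟩

theorem eq_gradInv (hA : Function.Injective A) {v : E} {w : W}
    (h : A.adjoint (A v) = A.adjoint w) : gradInv A w = v := by
  obtain ⟨e, he⟩ := isInvertible_adjoint_comp hA
  have h1 : gradInv A w = e.symm (A.adjoint w) := by
    simp only [gradInv, ContinuousLinearMap.comp_apply, ← he, ContinuousLinearMap.inverse_equiv]
    rfl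
  rw [h1, ← h, ContinuousLinearEquiv.symm_apply_eq]
  exact (DFunLike.congr_fun he v).symm

theorem adjoint_gradInv (hA : Function.Injective A) (w : W) :
    A.adjoint (A (gradInv A w)) = A.adjoint w := by
  obtain ⟨e, he⟩ := isInvertible_adjoint_comp hA
  have h2 : A.adjoint (A (e.symm (A.adjoint w))) = A.adjoint w := by
    have := DFunLike.congr_fun he (e.symm (A.adjoint w))
    rw [ContinuousLinearMap.comp_apply] at this
    rw [← this]
    exact e.apply_symm_apply _
  rw [eq_gradInv hA h2, h2]

theorem gradInv_apply_self (hA : Function.Injective A) (v : E) : gradInv A (A v) = v :=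
  eq_gradInv hA rfl

theorem inner_gradInv_comm (hA : Function.Injective A) (w w' : W) :
    inner ℝ w (A (gradInv A w')) = inner ℝ w' (A (gradInv A w)) := by
  rw [← ContinuousLinearMap.adjoint_inner_left, ← adjoint_gradInv hA w,
    ContinuousLinearMap.adjoint_inner_left, real_inner_comm,
    ← ContinuousLinearMap.adjoint_inner_left,
    adjoint_gradInv hA, ContinuousLinearMap.adjoint_inner_left]

theorem gradInv_comp_symm (hA : Function.Injective A) (T : E ≃L[ℝ] E) (w : W) :
    gradInv (A.comp (T.symm : E →L[ℝ] E)) w = T (gradInv A w) := by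
  refine eq_gradInv (fun a b h => T.symm.injective (hA h)) ?_
  rw [ContinuousLinearMap.adjoint_comp]
  simp [adjoint_gradInv hA]

theorem contDiffAt_gradInv (hA : Function.Injective A) :
    ContDiffAt ℝ ∞ (gradInv : (E →L[ℝ] W) → W →L[ℝ] E) A := by
  have hadj : ContDiff ℝ ∞ fun B : E →L[ℝ] W => B.adjoint :=
    (ContinuousLinearMap.adjoint (𝕜 := ℝ) (E := E) (F := W)).toContinuousLinearEquiv.contDiff
  obtain ⟨e, he⟩ := isInvertible_adjoint_comp hA
  have h1 : ContDiffAt ℝ ∞ ContinuousLinearMap.inverse (A.adjoint.comp A) := by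
    rw [← he]
    exact contDiffAt_map_inverse e
  have h2 : ContDiffAt ℝ ∞ (fun B : E →L[ℝ] W => B.adjoint.comp B) A :=
    (hadj.clm_comp contDiff_id).contDiffAt
  have h3 : ContDiffAt ℝ ∞ (fun B : E →L[ℝ] W => (B.adjoint.comp B).inverse) A :=
    ContDiffAt.comp (g := ContinuousLinearMap.inverse)
      (f := fun B : E →L[ℝ] W => B.adjoint.comp B) A h1 h2
  exact h3.clm_comp hadj.contDiffAt

end GradInv

section Frame

open Set Filter Topology Module

variable {n : ℕ} {M : Type*} [TopologicalSpace M] [ChartedSpace (EuclideanSpace ℝ (Fin n)) M]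
  [IsManifold (𝓡 n) ∞ M]

/-- The differential of a map into a vector space, as a linear map on the model space, which is
definitionally the tangent space. -/
noncomputable def modelDeriv {W : Type*} [NormedAddCommGroup W] [NormedSpace ℝ W]
    (F : M → W) (x : M) : EuclideanSpace ℝ (Fin n) →L[ℝ] W :=
  mfderiv (𝓡 n) 𝓘(ℝ, W) F x

/-- The pseudo-inverse of the differential of `F`, applied to `w`, as a vector field; for an
immersion `F` it is the gradient of the function `⟪w, F ·⟫` for the induced metric. -/
noncomputable def gradField {N : ℕ} (F : M → EuclideanSpace ℝ (Fin N))
    (w : EuclideanSpace ℝ (Fin N)) (x : M) : TangentSpace (𝓡 n) x :=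
  (gradInv (modelDeriv (n := n) F x) w : EuclideanSpace ℝ (Fin n))

theorem contMDiff_gradField {N : ℕ} {F : M → EuclideanSpace ℝ (Fin N)}
    (hF : ContMDiff (𝓡 n) 𝓘(ℝ, EuclideanSpace ℝ (Fin N)) ∞ F)
    (hinj : ∀ x, Function.Injective (modelDeriv (n := n) F x)) (w : EuclideanSpace ℝ (Fin N)) :
    ContMDiff (𝓡 n) ((𝓡 n).prod 𝓘(ℝ, EuclideanSpace ℝ (Fin n))) ∞
      (fun x => Bundle.TotalSpace.mk' (EuclideanSpace ℝ (Fin n))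
        (E := fun x : M => TangentSpace (𝓡 n) x) x (gradField F w x)) := by
  intro x₀
  refine (Bundle.contMDiffAt_section (s := gradField F w) x₀).2 ?_
  have h := (hF x₀).mfderiv_const (m := ∞) (by simp)
  set e := trivializationAt (EuclideanSpace ℝ (Fin n)) (TangentSpace (𝓡 n) : M → Type _) x₀ with he
  set A := inTangentCoordinates (𝓡 n) 𝓘(ℝ, EuclideanSpace ℝ (Fin N)) id F
    (mfderiv (𝓡 n) 𝓘(ℝ, EuclideanSpace ℝ (Fin N)) F) x₀ with hA
  have hx₀ : x₀ ∈ e.baseSet := mem_baseSet_trivializationAt _ _ x₀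
  let T : ∀ x, x ∈ e.baseSet → EuclideanSpace ℝ (Fin n) ≃L[ℝ] EuclideanSpace ℝ (Fin n) :=
    fun x hx => e.continuousLinearEquivAt ℝ x hx
  have hA' : ∀ x, ∀ hx : x ∈ e.baseSet, A x = (modelDeriv (n := n) F x).comp
      ((T x hx).symm : EuclideanSpace ℝ (Fin n) →L[ℝ] EuclideanSpace ℝ (Fin n)) := by
    intro x hx
    ext v : 1
    simp [hA, inTangentCoordinates, ContinuousLinearMap.inCoordinates, modelDeriv]
    exact congrArg (mfderiv (𝓡 n) 𝓘(ℝ, EuclideanSpace ℝ (Fin N)) F x)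
      (congrFun (Bundle.Trivialization.symm_continuousLinearEquivAt_eq (R := ℝ) e hx).symm v)
  have hAinj : Function.Injective (A x₀) := by
    rw [hA' x₀ hx₀]
    exact fun a b hab => (T x₀ hx₀).symm.injective (hinj x₀ hab)
  have h1 : ContMDiffAt (𝓡 n) 𝓘(ℝ, EuclideanSpace ℝ (Fin n)) ∞ (fun x => gradInv (A x) w) x₀ := by
    have h2 : ContDiffAt ℝ ∞ (fun B : EuclideanSpace ℝ (Fin n) →L[ℝ] EuclideanSpace ℝ (Fin N) =>
        gradInv B w) (A x₀) := (contDiffAt_gradInv hAinj).clm_apply contDiffAt_const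
    exact h2.contMDiffAt.comp x₀ h
  refine h1.congr_of_eventuallyEq ?_
  filter_upwards [e.open_baseSet.mem_nhds hx₀] with x hx
  rw [hA' x hx]
  exact (gradInv_comp_symm (hinj x) (T x hx) w).symm

end Frame

section Frame

open Set Filter Topology Module

variable {n : ℕ} {M : Type*} [TopologicalSpace M] [ChartedSpace (EuclideanSpace ℝ (Fin n)) M]
  [IsManifold (𝓡 n) ∞ M]

/-- A finite family of functions and vector fields with `v = ∑ k, df_k(v) X_k` for every tangent
vector `v`, and `X k (f l) = X l (f k)`. -/
structure IsFieldFrame {ι : Type*} [Fintype ι] (f : ι → SmoothFun n M) (X : ι → VectField n M) :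
    Prop where
  expand : ∀ (x : M) (v : TangentSpace (𝓡 n) x), v = ∑ k, mvfderiv (𝓡 n) (f k) x v • X k x
  symm : ∀ k l, vectAct (X k) (f l) = vectAct (X l) (f k)

/-- The components of an immersion and their gradients form a frame. -/
theorem exists_isFieldFrame (n : ℕ) (M : Type*) [TopologicalSpace M]
    [ChartedSpace (EuclideanSpace ℝ (Fin n)) M] [IsManifold (𝓡 n) ∞ M] [T2Space M]
    [SecondCountableTopology M] :
    ∃ (N : ℕ) (f : Fin N → SmoothFun n M) (X : Fin N → VectField n M), IsFieldFrame f X := by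
  obtain ⟨F, hF, hinj⟩ := exists_immersion n M
  have hinj' : ∀ x, Function.Injective (modelDeriv (n := n) F x) := hinj
  set b := EuclideanSpace.basisFun (Fin (2 * n + 1)) ℝ with hb
  set f : Fin (2 * n + 1) → SmoothFun n M := fun k =>
    ⟨fun x => F x k, (EuclideanSpace.proj k : EuclideanSpace ℝ (Fin (2 * n + 1)) →L[ℝ]
      ℝ).contMDiff.comp hF⟩ with hf
  set X : Fin (2 * n + 1) → VectField n M := fun k =>
    ⟨gradField F (b k), contMDiff_gradField hF hinj' (b k)⟩ with hX
  have hdf : ∀ k x (v : TangentSpace (𝓡 n) x),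
      mvfderiv (𝓡 n) (f k) x v = (modelDeriv (n := n) F x v) k := by
    intro k x v
    have h1 := mfderiv_comp (I := 𝓡 n) (I' := 𝓘(ℝ, EuclideanSpace ℝ (Fin (2 * n + 1))))
      (I'' := 𝓘(ℝ, ℝ)) x (g := fun w : EuclideanSpace ℝ (Fin (2 * n + 1)) => w k)
      ((EuclideanSpace.proj k : EuclideanSpace ℝ (Fin (2 * n + 1)) →L[ℝ]
        ℝ).differentiableAt.mdifferentiableAt) ((hF x).mdifferentiableAt (by simp))
    have h2 : mfderiv 𝓘(ℝ, EuclideanSpace ℝ (Fin (2 * n + 1))) 𝓘(ℝ, ℝ)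
        (fun w : EuclideanSpace ℝ (Fin (2 * n + 1)) => w k) (F x) =
        (EuclideanSpace.proj k : EuclideanSpace ℝ (Fin (2 * n + 1)) →L[ℝ] ℝ) := by
      rw [mfderiv_eq_fderiv]
      exact (EuclideanSpace.proj k : EuclideanSpace ℝ (Fin (2 * n + 1)) →L[ℝ] ℝ).fderiv
    rw [h2] at h1
    exact DFunLike.congr_fun h1 v
  refine ⟨2 * n + 1, f, X, fun x v => ?_, fun k l => ?_⟩
  · have h1 : modelDeriv (n := n) F x v = ∑ k, (modelDeriv (n := n) F x v) k • b k := by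
      have := (b.sum_repr (modelDeriv (n := n) F x v)).symm
      simpa [hb] using this
    have h2 := gradInv_apply_self (hinj' x) v
    rw [h1, map_sum] at h2
    simp only [map_smul] at h2
    refine h2.symm.trans ?_
    simp only [hdf]
    rfl
  · ext x
    have h1 := inner_gradInv_comm (hinj' x) (b k) (b l)
    rw [vectAct_apply, vectAct_apply, hdf, hdf]
    have h3 : ∀ (w : EuclideanSpace ℝ (Fin (2 * n + 1))) j, inner ℝ (b j) w = w j := by
      intro w j
      simp [hb, EuclideanSpace.inner_single_left]
    rw [h3, h3] at h1
    exact h1.symm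

/-- A vector field as a derivation of `C^∞(M)`. -/
noncomputable def vectDer (X : VectField n M) : Derivation ℝ (SmoothFun n M) (SmoothFun n M) :=
  Derivation.mk' (vectAct X) fun f g => vectAct_leibniz X f g

theorem vectDer_apply (X : VectField n M) (f : SmoothFun n M) : vectDer X f = vectAct X f := rfl

variable {ι : Type*} [Fintype ι] {f : ι → SmoothFun n M} {X : ι → VectField n M}

theorem smoothFun_sum_apply (a : ι → SmoothFun n M) (x : M) : (∑ k, a k) x = ∑ k, a k x := by
  have h := congrFun (map_sum (ContMDiffMap.coeFnAddMonoidHom (I := 𝓡 n) (I' := 𝓘(ℝ, ℝ)) (N := M)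
    (G := ℝ) (n := ∞)) a Finset.univ) x
  rw [Finset.sum_apply] at h
  exact h

/-- The vector field `∑ k, a k • X k`. -/
noncomputable def combField (a : ι → SmoothFun n M) (X : ι → VectField n M) : VectField n M :=
  ⟨fun x => ∑ k, a k x • X k x, .sum_section fun k _ =>
    ContMDiff.smul_section (a k).contMDiff (X k).contMDiff⟩

theorem combField_apply (a : ι → SmoothFun n M) (X : ι → VectField n M) (x : M) :
    combField a X x = ∑ k, a k x • X k x := rfl

theorem vectAct_combField (a : ι → SmoothFun n M) (X : ι → VectField n M) (g : SmoothFun n M) :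
    vectAct (combField a X) g = ∑ k, a k * vectAct (X k) g := by
  ext x
  rw [smoothFun_sum_apply, vectAct_apply, combField_apply, map_sum]
  simp only [map_smul]
  rfl

end Frame

/-! ### Derivations of the algebra of smooth functions -/

section Hadamard

open Set Filter Topology Module MeasureTheory

variable {n : ℕ}

/-- Averages of a smooth map along segments are smooth. The average is written as a convolution with
the indicator of `[0, 1]`, the parametrized integrand being cut off to have compact support. -/
theorem contDiff_segment_average {E F : Type*} [NormedAddCommGroup E] [NormedSpace ℝ E]
    [NormedAddCommGroup F] [NormedSpace ℝ F] {u : E → F} (hu : ContDiff ℝ ∞ u) (y₀ : E) :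
    ContDiff ℝ ∞ fun y => ∫ t in (0 : ℝ)..1, u (y₀ + t • (y - y₀)) := by
  let ρ : ContDiffBump (0 : ℝ) := ⟨2, 3, by norm_num, by norm_num⟩
  set g : E → ℝ → F := fun y t => ρ t • u (y₀ + (-t) • (y - y₀)) with hg
  have hgsmooth : ContDiffOn ℝ ((⊤ : ℕ∞) : WithTop ℕ∞) (Function.uncurry g) (univ ×ˢ univ) := by
    refine ContDiff.contDiffOn ?_
    refine ContDiff.smul (ρ.contDiff.comp contDiff_snd) (hu.comp ?_)
    exact contDiff_const.add ((contDiff_snd.neg).smul (contDiff_fst.sub contDiff_const))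
  have hint : LocallyIntegrable (indicator (Ioc (0 : ℝ) 1) fun _ => (1 : ℝ)) volume := by
    refine Integrable.locallyIntegrable ?_
    rw [integrable_indicator_iff measurableSet_Ioc]
    exact integrableOn_const (by simp)
  have key := contDiffOn_convolution_right_with_param_comp (𝕜 := ℝ) (n := ⊤) (μ := volume)
    (ContinuousLinearMap.lsmul ℝ ℝ) (s := (univ : Set E)) (v := fun _ => (0 : ℝ)) contDiffOn_const
    (f := indicator (Ioc (0 : ℝ) 1) fun _ => (1 : ℝ)) (g := g) (k := Metric.closedBall 0 3)
    isOpen_univ (isCompact_closedBall _ _) (fun y t _ ht => by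
      have h0 : ρ t = 0 := ρ.zero_of_le_dist (le_of_lt (not_le.1 ht))
      simp [hg, h0]) hint hgsmooth
  rw [contDiffOn_univ] at key
  convert! key using 1
  funext y
  rw [intervalIntegral.integral_of_le zero_le_one, ← integral_indicator measurableSet_Ioc]
  refine integral_congr_ae (Eventually.of_forall fun t => ?_)
  by_cases ht : t ∈ Ioc (0 : ℝ) 1
  · have h1 : ρ (-t) = 1 := ρ.one_of_mem_closedBall (by
      simp only [Metric.mem_closedBall, dist_zero_right, norm_neg, Real.norm_eq_abs]
      rw [abs_of_pos ht.1]
      linarith [ht.2])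
    simp [ht, hg, h1]
  · simp [ht]

/-- Hadamard's lemma, with the additional fact that the coefficients vanish at `y₀` when the
differential does. -/
theorem exists_hadamard {u : EuclideanSpace ℝ (Fin n) → ℝ} (hu : ContDiff ℝ ∞ u)
    (y₀ : EuclideanSpace ℝ (Fin n)) :
    ∃ H : Fin n → EuclideanSpace ℝ (Fin n) → ℝ, (∀ j, ContDiff ℝ ∞ (H j)) ∧
      (∀ y, u y = u y₀ + ∑ j, (y - y₀) j * H j y) ∧
      (fderiv ℝ u y₀ = 0 → ∀ j, H j y₀ = 0) := by
  have hdu : ContDiff ℝ ∞ (fderiv ℝ u) := hu.fderiv_right (by simp)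
  have hD := contDiff_segment_average hdu y₀
  refine ⟨fun j y => (∫ t in (0 : ℝ)..1, fderiv ℝ u (y₀ + t • (y - y₀)))
    (EuclideanSpace.single j 1), fun j => hD.clm_apply contDiff_const, fun y => ?_, fun h0 j => ?_⟩
  · have hcont : Continuous fun t : ℝ => fderiv ℝ u (y₀ + t • (y - y₀)) :=
      hdu.continuous.comp (by fun_prop)
    have h1 : ∀ t : ℝ, HasDerivAt (fun t : ℝ => u (y₀ + t • (y - y₀)))
        (fderiv ℝ u (y₀ + t • (y - y₀)) (y - y₀)) t := by
      intro t
      have h2 : HasDerivAt (fun t : ℝ => y₀ + t • (y - y₀)) (y - y₀) t := by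
        simpa using ((hasDerivAt_id t).smul_const (y - y₀)).const_add y₀
      exact ((hu.differentiable (by simp)) _).hasFDerivAt.comp_hasDerivAt t h2
    have h3 := intervalIntegral.integral_eq_sub_of_hasDerivAt (a := 0) (b := 1)
      (fun t _ => h1 t) ((hcont.clm_apply continuous_const).intervalIntegrable _ _)
    rw [← ContinuousLinearMap.intervalIntegral_apply (hcont.intervalIntegrable _ _)] at h3
    have h4 : y - y₀ = ∑ j, (y - y₀) j • (EuclideanSpace.single j (1 : ℝ)) := by
      have := ((EuclideanSpace.basisFun (Fin n) ℝ).sum_repr (y - y₀)).symm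
      simpa using this
    have h5 : (∫ t in (0 : ℝ)..1, fderiv ℝ u (y₀ + t • (y - y₀))) (y - y₀) =
        ∑ j, (y - y₀) j * (∫ t in (0 : ℝ)..1, fderiv ℝ u (y₀ + t • (y - y₀)))
          (EuclideanSpace.single j 1) := by
      conv_lhs => arg 2; rw [h4]
      rw [map_sum]
      simp only [map_smul, smul_eq_mul]
    rw [← h5, h3]
    simp
  · simp [h0]

end Hadamard

section VectorFields

open Set Filter Topology Module

variable {n : ℕ} {M : Type*} [TopologicalSpace M] [ChartedSpace (EuclideanSpace ℝ (Fin n)) M]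
  [IsManifold (𝓡 n) ∞ M] [T2Space M]

/-- A derivation of `C^∞(M)` vanishes at `x` on the functions whose differential at `x` is zero. -/
theorem derivation_apply_eq_zero (P : Derivation ℝ (SmoothFun n M) (SmoothFun n M))
    {g : SmoothFun n M} {x : M} (hg : mvfderiv (𝓡 n) g x = 0) : P g x = 0 := by
  -- subtracting a constant, `g` may be assumed to vanish at `x`
  wlog hgx : g x = 0 generalizing g
  · set c : SmoothFun n M := algebraMap ℝ (SmoothFun n M) (g x) with hc
    have hdc : mvfderiv (𝓡 n) (g - c) x = 0 := by
      have h1 := mvfderiv_sub (mdiffAt g x) (mdiffAt c x)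
      have h2 : mvfderiv (𝓡 n) c x = 0 := mvfderiv_const (g x)
      rw [hg, h2, sub_zero] at h1
      exact h1
    have h := this hdc (sub_self (g x))
    rwa [map_sub, hc, Derivation.map_algebraMap, sub_zero] at h
  obtain ⟨χ⟩ : Nonempty (SmoothBumpFunction (𝓡 n) x) := inferInstance
  set ψ := extChartAt (𝓡 n) x with hψ
  set u : EuclideanSpace ℝ (Fin n) → ℝ := fun y => χ.toContDiffBump y * g (ψ.symm y) with hu
  have hball : Metric.closedBall (ψ x) χ.rOut ⊆ ψ.target := by
    have := χ.closedBall_subset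
    rwa [ModelWithCorners.range_eq_univ, inter_univ] at this
  have husmooth : ContDiff ℝ ∞ u := by
    rw [contDiff_iff_contDiffAt]
    intro y
    by_cases hy : y ∈ ψ.target
    · exact χ.toContDiffBump.contDiff.contDiffAt.mul (contDiffAt_local g x hy)
    · have hy' : y ∉ tsupport χ.toContDiffBump := by
        rw [χ.toContDiffBump.tsupport_eq]
        exact fun h => hy (hball h)
      have h0 : u =ᶠ[𝓝 y] fun _ => 0 := by
        filter_upwards [notMem_tsupport_iff_eventuallyEq.1 hy'] with z hz
        simp only [hu, hz, Pi.zero_apply, zero_mul]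
      exact contDiffAt_const.congr_of_eventuallyEq h0
  have hux : u (ψ x) = 0 := by
    simp only [hu, hψ, extChartAt_to_inv, hgx, mul_zero]
  have hdu : fderiv ℝ u (ψ x) = 0 := by
    have h1 : u =ᶠ[𝓝 (ψ x)] fun y => g (ψ.symm y) := by
      filter_upwards [χ.toContDiffBump.eventuallyEq_one] with z hz
      simp only [hu, hz, Pi.one_apply, one_mul]
    rw [h1.fderiv_eq, fderiv_local g x (mem_extChartAt_target x), extChartAt_to_inv, hg]
    rfl
  obtain ⟨H, hH, hexp, hH0⟩ := exists_hadamard husmooth (ψ x)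
  set χ' : SmoothFun n M := ⟨χ, χ.contMDiff⟩ with hχ'
  have hχx : χ' x = 1 := χ.eq_one
  have hψs : ContMDiffOn (𝓡 n) 𝓘(ℝ, EuclideanSpace ℝ (Fin n)) ∞ ψ
      (chartAt (EuclideanSpace ℝ (Fin n)) x).source := contMDiffOn_extChartAt
  set a : Fin n → SmoothFun n M := fun j => ⟨fun z => χ z • (ψ z - ψ x) j,
    χ.contMDiff_smul (g := fun z => (ψ z - ψ x) j) (by
      have h1 : ContDiff ℝ ∞ fun y : EuclideanSpace ℝ (Fin n) => (y - ψ x) j :=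
        (contDiff_euclidean.1 (contDiff_id.sub contDiff_const)) j
      exact h1.contMDiff.comp_contMDiffOn hψs)⟩ with ha
  set b : Fin n → SmoothFun n M := fun j => ⟨fun z => χ z • H j (ψ z),
    χ.contMDiff_smul (g := fun z => H j (ψ z)) ((hH j).contMDiff.comp_contMDiffOn hψs)⟩ with hb
  have hprod : χ' * (χ' * (χ' * g)) = ∑ j, a j * b j := by
    ext z
    rw [smoothFun_sum_apply]
    change χ z * (χ z * (χ z * g z)) = ∑ j, (χ z * (ψ z - ψ x) j) * (χ z * H j (ψ z))
    by_cases hz : z ∈ (chartAt (EuclideanSpace ℝ (Fin n)) x).source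
    · have h1 : χ z = χ.toContDiffBump (ψ z) := χ.eqOn_source hz
      have h2 : χ z * g z = u (ψ z) := by
        simp only [hu, ψ.left_inv (by simpa [hψ] using hz), ← h1]
      rw [h2, hexp, hux, zero_add, Finset.mul_sum, Finset.mul_sum]
      exact Finset.sum_congr rfl fun j _ => by ring
    · have h1 : χ z = 0 := by
        by_contra h
        exact hz (χ.support_subset_source h)
      simp [h1]
  have hP := congrArg (fun k : SmoothFun n M => k x) (congrArg P hprod)
  simp only [Derivation.leibniz, map_sum, smul_eq_mul, smoothFun_sum_apply] at hP
  have hL : (χ' * (χ' * (χ' * P g + g * P χ') + χ' * g * P χ') + χ' * (χ' * g) * P χ') x =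
      P g x := by
    change χ' x * (χ' x * (χ' x * P g x + g x * P χ' x) + χ' x * g x * P χ' x) +
      χ' x * (χ' x * g x) * P χ' x = _
    rw [hχx, hgx]
    ring
  rw [hL] at hP
  rw [hP]
  refine Finset.sum_eq_zero fun j _ => ?_
  have h1 : a j x = 0 := by
    change χ x * (ψ x - ψ x) j = 0
    simp
  have h2 : b j x = 0 := by
    change χ x * H j (ψ x) = 0
    rw [hH0 hdu, mul_zero]
  change a j x * P (b j) x + b j x * P (a j) x = 0
  rw [h1, h2]
  ring

variable {ι : Type*} [Fintype ι] {f : ι → SmoothFun n M} {X : ι → VectField n M}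

/-- Every derivation of `C^∞(M)` is the vector field `∑ k, P (f k) X k`. -/
theorem IsFieldFrame.derivation_eq (hf : IsFieldFrame f X)
    (P : Derivation ℝ (SmoothFun n M) (SmoothFun n M)) :
    P = vectDer (combField (fun k => P (f k)) X) := by
  ext g x
  rw [vectDer_apply, vectAct_combField, smoothFun_sum_apply]
  -- subtract from `g` the combination of the `f k` with the same differential at `x`
  set c : ι → ℝ := fun k => vectAct (X k) g x with hc
  set g' : SmoothFun n M := g - ∑ k, c k • f k with hg'
  have h1 : mvfderiv (𝓡 n) g' x = 0 := by
    have e : mvfderiv (𝓡 n) g' x = d g' x := rfl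
    ext v
    rw [e, hg', map_sub, map_sum]
    simp only [map_smul]
    have e2 : (d g - ∑ k, c k • d (f k)) x = d g x - ∑ k, c k • d (f k) x := by
      rw [ContMDiffSection.coe_sub, Pi.sub_apply]
      congr 1
      have := congrFun (map_sum (ContMDiffSection.coeAddHom (𝓡 n)
        (EuclideanSpace ℝ (Fin n) →L[ℝ] ℝ) ∞
        (fun x : M => TangentSpace (𝓡 n) x →L[ℝ] Bundle.Trivial M ℝ x))
        (fun k => c k • d (f k)) Finset.univ) x
      rw [Finset.sum_apply] at this
      exact this
    rw [e2]
    have h3 : d g x v = ∑ k, mvfderiv (𝓡 n) (f k) x v * c k := by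
      conv_lhs => rw [hf.expand x v, map_sum]
      simp only [map_smul]
      rfl
    have h4 : (∑ k, c k • d (f k) x) v = ∑ k, mvfderiv (𝓡 n) (f k) x v * c k := by
      rw [_root_.sum_apply]
      exact Finset.sum_congr rfl fun k _ => mul_comm _ _
    exact (sub_eq_zero.2 (h3.trans h4.symm))
  have h2 := derivation_apply_eq_zero P h1
  rw [hg', map_sub, map_sum] at h2
  have h3 : P g x = ∑ k, (P (c k • f k)) x := by
    rw [← smoothFun_sum_apply]
    exact sub_eq_zero.1 h2
  rw [h3]
  refine Finset.sum_congr rfl fun k _ => ?_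
  rw [Derivation.map_smul]
  exact mul_comm _ _

/-- The Lie algebra `D¹(M)` is the algebraic one. -/
theorem IsFieldFrame.d1_eq_firstOrder (hf : IsFieldFrame f X) :
    D1 n M = firstOrder (SmoothFun n M) := by
  ext D
  constructor
  · rintro ⟨Y, g, rfl⟩
    exact ⟨vectDer Y, g, rfl⟩
  · rintro ⟨P, g, rfl⟩
    refine ⟨combField (fun k => P (f k)) X, g, ?_⟩
    conv_lhs => rw [hf.derivation_eq P]
    rfl

end VectorFields

/-! ### The algebra of smooth functions on a connected manifold -/

section SmoothAlgebra

open Set Filter Topology Module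

variable {n : ℕ} {M : Type*} [TopologicalSpace M] [ChartedSpace (EuclideanSpace ℝ (Fin n)) M]
  [IsManifold (𝓡 n) ∞ M]
variable {ι : Type*} [Fintype ι] {f : ι → SmoothFun n M} {X : ι → VectField n M}

/-- The trace of the identity of the tangent space is the dimension. -/
theorem IsFieldFrame.sum_vectAct (hf : IsFieldFrame f X) :
    ∑ k, vectAct (X k) (f k) = algebraMap ℝ (SmoothFun n M) n := by
  ext x
  rw [smoothFun_sum_apply]
  change _ = (n : ℝ)
  set b := EuclideanSpace.basisFun (Fin n) ℝ with hb
  have h1 : ∀ i, (1 : ℝ) = ∑ k, mvfderiv (𝓡 n) (f k) x (b i) *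
      (show EuclideanSpace ℝ (Fin n) from X k x) i := by
    intro i
    have h := congrArg (fun v : EuclideanSpace ℝ (Fin n) => v i) (hf.expand x (b i))
    have h2 : (b i) i = (1 : ℝ) := by simp [hb]
    rw [← h2]
    refine h.trans ?_
    exact (map_sum (EuclideanSpace.proj i : EuclideanSpace ℝ (Fin n) →L[ℝ] ℝ) _ _)
  have h2 : ∀ k, vectAct (X k) (f k) x =
      ∑ i, mvfderiv (𝓡 n) (f k) x (b i) * (show EuclideanSpace ℝ (Fin n) from X k x) i := by
    intro k
    rw [vectAct_apply]
    have h3 : X k x = ∑ i, (show EuclideanSpace ℝ (Fin n) from X k x) i • (b i) := by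
      have := (b.sum_repr (X k x)).symm
      simpa [hb] using! this
    conv_lhs => rw [h3]
    refine (map_sum (mvfderiv (𝓡 n) (f k) x) _ _).trans (Finset.sum_congr rfl fun i _ => ?_)
    exact (map_smul (mvfderiv (𝓡 n) (f k) x) _ _).trans (mul_comm _ _)
  rw [Finset.sum_congr rfl fun k _ => h2 k, Finset.sum_comm,
    ← Finset.sum_congr rfl fun i _ => h1 i]
  simp

theorem IsFieldFrame.isGradientFrame [T2Space M] (hf : IsFieldFrame f X) (hn : n ≠ 0) :
    IsGradientFrame f fun k => vectDer (X k) where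
  expand D := by
    conv_lhs => rw [hf.derivation_eq D]
    ext1 g
    rw [vectDer_apply, vectAct_combField, derivation_sum_apply]
    rfl
  symm := hf.symm
  trace := by
    have h : IsUnit (∑ k, vectAct (X k) (f k)) := by
      rw [hf.sum_vectAct]
      exact (IsUnit.mk0 (n : ℝ) (Nat.cast_ne_zero.2 hn)).map _
    exact h

/-- Evaluation at a point, as a character of `C^∞(M)`. -/
noncomputable def evalHom (x : M) : SmoothFun n M →ₐ[ℝ] ℝ where
  toFun g := g x
  map_one' := rfl
  map_mul' _ _ := rfl
  map_zero' := rfl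
  map_add' _ _ := rfl
  commutes' _ := rfl

/-- A function killed by all vector fields on a connected manifold is constant. -/
theorem IsFieldFrame.exists_eq_algebraMap [ConnectedSpace M] (hf : IsFieldFrame f X)
    {g : SmoothFun n M}
    (hg : ∀ D : Derivation ℝ (SmoothFun n M) (SmoothFun n M), D g = 0) :
    ∃ c : ℝ, g = algebraMap ℝ (SmoothFun n M) c := by
  have hd : ∀ x, mvfderiv (𝓡 n) g x = 0 := by
    intro x
    ext v
    conv_lhs => rw [hf.expand x v, map_sum]
    refine Finset.sum_eq_zero fun k _ => ?_
    rw [map_smul]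
    have h : mvfderiv (𝓡 n) g x (X k x) = 0 :=
      congrArg (fun u : SmoothFun n M => u x) (hg (vectDer (X k)))
    rw [h, smul_zero]
  have hloc : IsLocallyConstant g := by
    rw [IsLocallyConstant.iff_eventually_eq]
    intro x
    have hx := mem_extChartAt_target (I := 𝓡 n) x
    obtain ⟨r, hr, hball⟩ := Metric.isOpen_iff.1 (isOpen_extTarget x) _ hx
    have h1 : ∀ᶠ z in 𝓝 x, extChartAt (𝓡 n) x z ∈ Metric.ball (extChartAt (𝓡 n) x x) r :=
      (continuousAt_extChartAt x).eventually_mem (Metric.ball_mem_nhds _ hr)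
    filter_upwards [h1, extChartAt_source_mem_nhds (I := 𝓡 n) x] with z hz hzs
    have h2 := (Metric.isOpen_ball).is_const_of_fderiv_eq_zero (𝕜 := ℝ)
      (f := fun y => g ((extChartAt (𝓡 n) x).symm y)) (convex_ball _ r).isPreconnected
      (fun y hy => ((contDiffAt_local g x (hball hy)).differentiableAt
        (by simp)).differentiableWithinAt) (fun y hy => by
          rw [fderiv_local g x (hball hy), hd]
          rfl) hz (Metric.mem_ball_self hr)
    simpa only [(extChartAt (𝓡 n) x).left_inv hzs, extChartAt_to_inv] using h2
  obtain ⟨x₀⟩ : Nonempty M := inferInstance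
  exact ⟨g x₀, ContMDiffMap.ext fun x => hloc.apply_eq_of_preconnectedSpace x x₀⟩

end SmoothAlgebra

/-! ### Closed forms and the computation of the cohomology -/

section ClosedForms

open Set Filter Topology Module

variable {n : ℕ} {M : Type*} [TopologicalSpace M] [ChartedSpace (EuclideanSpace ℝ (Fin n)) M]
  [IsManifold (𝓡 n) ∞ M]
variable {ι : Type*} [Fintype ι] {f : ι → SmoothFun n M} {X : ι → VectField n M}

theorem IsFieldFrame.form_apply (hf : IsFieldFrame f X) (α : OneForm n M) (x : M)
    (v : TangentSpace (𝓡 n) x) :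
    α x v = ∑ k, contract α (X k) x * mvfderiv (𝓡 n) (f k) x v := by
  conv_lhs => rw [hf.expand x v, map_sum]
  refine Finset.sum_congr rfl fun k _ => ?_
  rw [map_smul]
  exact mul_comm _ _

theorem IsFieldFrame.exists_field (hf : IsFieldFrame f X) (x : M) (v : TangentSpace (𝓡 n) x) :
    ∃ Y : VectField n M, Y x = v :=
  ⟨combField (fun k => algebraMap ℝ _ (mvfderiv (𝓡 n) (f k) x v)) X, (hf.expand x v).symm⟩

/-- The exterior derivative in a chart of `α = ∑ k, α(X k) d(f k)` is `∑ k, d(α(X k)) ∧ d(f k)`. -/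
theorem IsFieldFrame.fderiv_chartForm_sub (hf : IsFieldFrame f X) (α : OneForm n M) (x₀ : M)
    {y : EuclideanSpace ℝ (Fin n)} (hy : y ∈ (extChartAt (𝓡 n) x₀).target)
    (u v : EuclideanSpace ℝ (Fin n)) :
    fderiv ℝ (chartForm α x₀) y u v - fderiv ℝ (chartForm α x₀) y v u =
      ∑ k, (fderiv ℝ (fun z => contract α (X k) ((extChartAt (𝓡 n) x₀).symm z)) y u *
          fderiv ℝ (fun z => f k ((extChartAt (𝓡 n) x₀).symm z)) y v -
        fderiv ℝ (fun z => contract α (X k) ((extChartAt (𝓡 n) x₀).symm z)) y v *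
          fderiv ℝ (fun z => f k ((extChartAt (𝓡 n) x₀).symm z)) y u) := by
  set a : ι → EuclideanSpace ℝ (Fin n) → ℝ :=
    fun k z => contract α (X k) ((extChartAt (𝓡 n) x₀).symm z) with ha
  set φ : ι → EuclideanSpace ℝ (Fin n) → ℝ :=
    fun k z => f k ((extChartAt (𝓡 n) x₀).symm z) with hφ
  have heq : chartForm α x₀ =ᶠ[𝓝 y] fun z => ∑ k, a k z • fderiv ℝ (φ k) z := by
    filter_upwards [(isOpen_extTarget x₀).mem_nhds hy] with z hz
    ext w
    rw [_root_.sum_apply]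
    refine (hf.form_apply α _ _).trans (Finset.sum_congr rfl fun k _ => ?_)
    rw [hφ, fderiv_local (f k) x₀ hz]
    rfl
  have hφ2 : ∀ k, ContDiffAt ℝ ∞ (φ k) y := fun k => contDiffAt_local (f k) x₀ hy
  have hder : HasFDerivAt (fun z => ∑ k, a k z • fderiv ℝ (φ k) z)
      (∑ k, (a k y • fderiv ℝ (fderiv ℝ (φ k)) y + (fderiv ℝ (a k) y).smulRight
        (fderiv ℝ (φ k) y))) y := by
    refine HasFDerivAt.fun_sum fun k _ => ?_
    have h1 := ((contDiffAt_local (contract α (X k)) x₀ hy).differentiableAt (by simp)).hasFDerivAt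
    have h2 := (((hφ2 k).fderiv_right (m := 1) (by
      rw [one_add_one_eq_two]; exact two_le_infty)).differentiableAt (by simp)).hasFDerivAt
    exact h1.smul h2
  rw [heq.fderiv_eq, hder.fderiv]
  simp only [_root_.sum_apply, ← Finset.sum_sub_distrib]
  refine Finset.sum_congr rfl fun k _ => ?_
  have hs := (hφ2 k).isSymmSndFDerivAt (by simpa using two_le_infty) u v
  simp only [_root_.add_apply, _root_.smul_apply, ContinuousLinearMap.smulRight_apply, smul_eq_mul,
    hs]
  ring

theorem IsFieldFrame.mem_closedForms_iff (hf : IsFieldFrame f X) (α : OneForm n M) :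
    α ∈ closedForms n M ↔ ∀ (x : M) (u v : TangentSpace (𝓡 n) x),
      ∑ k, (mvfderiv (𝓡 n) (contract α (X k)) x u * mvfderiv (𝓡 n) (f k) x v -
        mvfderiv (𝓡 n) (contract α (X k)) x v * mvfderiv (𝓡 n) (f k) x u) = 0 := by
  constructor
  · intro h x u v
    have hx := mem_extChartAt_target (I := 𝓡 n) x
    -- at `x` itself, the tangent space is identified with the model space by the chart at `x`
    have e : ∀ (g : SmoothFun n M) (w : EuclideanSpace ℝ (Fin n)), mvfderiv (𝓡 n) g x w =
        fderiv ℝ (fun z => g ((extChartAt (𝓡 n) x).symm z)) (extChartAt (𝓡 n) x x) w := by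
      intro g w
      rw [(mdiffAt g x).mvfderiv, ModelWithCorners.range_eq_univ, fderivWithin_univ]
      rfl
    have key := (hf.fderiv_chartForm_sub α x hx u v).symm.trans (h x _ hx u v)
    refine Eq.trans (Finset.sum_congr rfl fun k _ => ?_) key
    exact congrArg₂ (· - ·) (congrArg₂ (· * ·) (e _ u) (e _ v)) (congrArg₂ (· * ·) (e _ v) (e _ u))
  · intro h x₀ y hy u v
    rw [hf.fderiv_chartForm_sub α x₀ hy u v]
    simp only [fderiv_local _ x₀ hy]
    exact h _ _ _

/-- The evaluation `P ↦ α(P)` of a `1`-form `α` on derivations, computed in a frame: derivations are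
not vector fields by definition, so `α(P)` is written as `∑ k, P (f k) α(X k)`. -/
noncomputable def formPairing (f : ι → SmoothFun n M) (X : ι → VectField n M) :
    OneForm n M →ₗ[ℝ] Derivation ℝ (SmoothFun n M) (SmoothFun n M) →ₗ[ℝ] SmoothFun n M where
  toFun α :=
    { toFun := fun P => ∑ k, P (f k) * contract α (X k)
      map_add' := fun P Q => by simp [add_mul, Finset.sum_add_distrib]
      map_smul' := fun c P => by simp [Finset.smul_sum] }
  map_add' α β := by
    ext1 P
    have h : ∀ k, contract (α + β) (X k) = contract α (X k) + contract β (X k) := fun k => rfl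
    simp [h, mul_add, Finset.sum_add_distrib]
  map_smul' c α := by
    ext1 P
    have h : ∀ k, contract (c • α) (X k) = c • contract α (X k) := fun k => rfl
    simp [h, Finset.smul_sum]

theorem formPairing_apply (α : OneForm n M)
    (P : Derivation ℝ (SmoothFun n M) (SmoothFun n M)) :
    formPairing f X α P = ∑ k, P (f k) * contract α (X k) := rfl

theorem IsFieldFrame.formPairing_vectDer (hf : IsFieldFrame f X) (α : OneForm n M)
    (Y : VectField n M) : formPairing f X α (vectDer Y) = contract α Y := by
  ext x
  rw [formPairing_apply, smoothFun_sum_apply]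
  exact (Finset.sum_congr rfl fun k _ => mul_comm _ _).trans (hf.form_apply α x (Y x)).symm

/-- A `1`-form is closed if and only if the `A`-linear map it defines on derivations is a
Chevalley–Eilenberg cocycle: both mean that `∑ k, d(α(X k)) ∧ d(f k)` vanishes. -/
theorem IsFieldFrame.mem_closedForms_iff_isClosedForm [T2Space M] (hf : IsFieldFrame f X)
    (α : OneForm n M) : α ∈ closedForms n M ↔ IsClosedForm (formPairing f X α) := by
  have hsmul : ∀ (h : SmoothFun n M) (P : Derivation ℝ (SmoothFun n M) (SmoothFun n M)),
      formPairing f X α (h • P) = h * formPairing f X α P := by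
    intro h P
    simp [formPairing_apply, Finset.mul_sum, mul_assoc]
  have hco : IsCocycle (formPairing f X α) ↔
      ∀ P Q : Derivation ℝ (SmoothFun n M) (SmoothFun n M),
        ∑ k, (P (contract α (X k)) * Q (f k) - Q (contract α (X k)) * P (f k)) = 0 := by
    refine forall₂_congr fun P Q => ?_
    rw [← sub_eq_zero, ← neg_eq_zero]
    refine Eq.congr ?_ rfl
    simp only [formPairing_apply, map_sum, Derivation.leibniz, Derivation.commutator_apply,
      smul_eq_mul, ← Finset.sum_sub_distrib, ← Finset.sum_neg_distrib]
    exact Finset.sum_congr rfl fun k _ => by ring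
  rw [IsClosedForm, and_iff_left hsmul, hco, hf.mem_closedForms_iff]
  have hval : ∀ (Y Z : VectField n M) (x : M),
      (∑ k, (vectDer Y (contract α (X k)) * vectDer Z (f k) -
        vectDer Z (contract α (X k)) * vectDer Y (f k)) : SmoothFun n M) x =
      ∑ k, (mvfderiv (𝓡 n) (contract α (X k)) x (Y x) * mvfderiv (𝓡 n) (f k) x (Z x) -
        mvfderiv (𝓡 n) (contract α (X k)) x (Z x) * mvfderiv (𝓡 n) (f k) x (Y x)) := by
    intro Y Z x
    rw [smoothFun_sum_apply]
    rfl
  constructor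
  · intro h P Q
    rw [hf.derivation_eq P, hf.derivation_eq Q]
    ext x
    rw [hval, h]
    rfl
  · intro h x u v
    obtain ⟨Y, rfl⟩ := hf.exists_field x u
    obtain ⟨Z, rfl⟩ := hf.exists_field x v
    rw [← hval, h]
    rfl

/-- The `1`-form `∑ k, a k d(f k)`. -/
noncomputable def combForm (a f : ι → SmoothFun n M) : OneForm n M :=
  ⟨fun x => ∑ k, a k x • d (f k) x, .sum_section fun k _ =>
    ContMDiff.smul_section (a k).contMDiff (d (f k)).contMDiff⟩

theorem contract_combForm (a f : ι → SmoothFun n M) (Y : VectField n M) :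
    contract (combForm a f) Y = ∑ k, a k * vectAct Y (f k) := by
  ext x
  rw [smoothFun_sum_apply]
  change (∑ k, a k x • d (f k) x) (Y x) = _
  exact _root_.sum_apply _ _ _

/-- Every `C^∞(M)`-linear map `Der C^∞(M) → C^∞(M)` comes from a `1`-form. -/
theorem IsFieldFrame.exists_formPairing_eq [T2Space M] (hf : IsFieldFrame f X)
    {θ : Derivation ℝ (SmoothFun n M) (SmoothFun n M) →ₗ[ℝ] SmoothFun n M}
    (hθ : ∀ (h : SmoothFun n M) P, θ (h • P) = h * θ P) : ∃ α, formPairing f X α = θ := by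
  refine ⟨combForm (fun k => θ (vectDer (X k))) f, LinearMap.ext fun P => ?_⟩
  rw [hf.derivation_eq P, hf.formPairing_vectDer, contract_combForm]
  have h : ∀ Y, vectDer Y = ∑ k, vectAct Y (f k) • vectDer (X k) := by
    intro Y
    conv_lhs => rw [hf.derivation_eq (vectDer Y)]
    ext1 g
    rw [vectDer_apply, vectAct_combField, derivation_sum_apply]
    rfl
  conv_rhs => rw [h, map_sum]
  exact Finset.sum_congr rfl fun k _ => by rw [hθ, mul_comm]

theorem IsFieldFrame.formPairing_d [T2Space M] (hf : IsFieldFrame f X) (g : SmoothFun n M)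
    (P : Derivation ℝ (SmoothFun n M) (SmoothFun n M)) : formPairing f X (d g) P = P g := by
  rw [hf.derivation_eq P, hf.formPairing_vectDer]
  rfl

theorem IsFieldFrame.formPairing_injective (hf : IsFieldFrame f X) :
    Function.Injective (formPairing f X) := by
  intro α β h
  ext x v
  obtain ⟨Y, rfl⟩ := hf.exists_field x v
  have h1 : contract α Y = contract β Y := by
    rw [← hf.formPairing_vectDer, ← hf.formPairing_vectDer, h]
  exact congrArg (fun g : SmoothFun n M => g x) h1

/-- The algebraic computation of the cohomology, for the algebra `C^∞(M)`. The Lie algebra `L` is a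
variable because rewriting inside the type of the cohomology is expensive. -/
theorem IsFieldFrame.nonempty_cohomology_equiv_deRham [T2Space M] [ConnectedSpace M]
    (hf : IsFieldFrame f X) (hn : n ≠ 0) {L : LieSubalgebra ℝ (Module.End ℝ (SmoothFun n M))}
    (hL : L = firstOrder (SmoothFun n M)) :
    Nonempty (CEH1 ℝ L L ≃ₗ[ℝ] ((ℝ × ℝ) × DeRhamH1 n M)) := by
  subst hL
  have : Nontrivial (SmoothFun n M) :=
    (evalHom (Classical.arbitrary M)).toRingHom.domain_nontrivial
  have hΘ : ∀ θ, IsClosedForm θ ↔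
      ∃ v, (formPairing f X ∘ₗ (closedForms n M).subtype) v = θ := by
    intro θ
    constructor
    · intro hθ
      obtain ⟨α, rfl⟩ := hf.exists_formPairing_eq hθ.2
      exact ⟨⟨α, (hf.mem_closedForms_iff_isClosedForm α).2 hθ⟩, rfl⟩
    · rintro ⟨α, rfl⟩
      exact (hf.mem_closedForms_iff_isClosedForm α.1).1 α.2
  have hB : ∀ v, v ∈ LinearMap.range (d.codRestrict (closedForms n M) d_mem_closedForms) ↔
      ∃ g, ∀ P : Derivation ℝ (SmoothFun n M) (SmoothFun n M),
        (formPairing f X ∘ₗ (closedForms n M).subtype) v P = P g := by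
    intro α
    constructor
    · rintro ⟨g, rfl⟩
      exact ⟨g, hf.formPairing_d g⟩
    · rintro ⟨g, hg⟩
      refine ⟨g, Subtype.ext (hf.formPairing_injective (LinearMap.ext fun P => ?_))⟩
      exact (hf.formPairing_d g P).trans (hg P).symm
  exact (hf.isGradientFrame hn).nonempty_cohomology_equiv
    (fun a ha => ContMDiffMap.ext fun x => ha (evalHom x))
    (fun a ha => hf.exists_eq_algebraMap ha) hΘ _ hB

end ClosedForms

end DiffOp

theorem corollary1 (n : ℕ) (hn : 1 ≤ n) (M : Type*) [TopologicalSpace M]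
    [ChartedSpace (EuclideanSpace ℝ (Fin n)) M] [IsManifold (𝓡 n) ∞ M]
    [T2Space M] [SecondCountableTopology M] [ConnectedSpace M] :
    Nonempty (DiffOp.CEH1 ℝ (DiffOp.D1 n M) (DiffOp.D1 n M) ≃ₗ[ℝ]
      ((ℝ × ℝ) × DiffOp.DeRhamH1 n M)) := by
  refine (DiffOp.exists_isFieldFrame n M).elim fun N h => h.elim fun f h => h.elim fun X hf => ?_
  exact hf.nonempty_cohomology_equiv_deRham (Nat.one_le_iff_ne_zero.1 hn) hf.d1_eq_firstOrder
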